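/- Let $I\subset\mathbb R$ be an open interval, let $f,D\in C^2(I)$ and let $d>0$ be such that $D(u)\ge d$ for all $u\in I$. Let $\alpha<\beta$ with $[\alpha,\beta]\subset I$, and assume $$f(\alpha)=f(\beta)=0,\qquad f'(\alpha)>0,\quad f'(\beta)>0,$$ $$\int_\alpha^\beta f(s)D(s)\,ds=0,\qquad G(u):=\int_\alpha^u f(s)D(s)\,ds>0\quad\text{for all }u\in I\setminus\{\alpha,\beta\}.$$ Put $$\lambda:=\min\left\{\frac{f'(\alpha)}{D(\alpha)},\frac{f'(\beta)}{D(\beta)}\right\},\qquad \gamma_0:=\int_\alpha^\beta\sqrt{2G(s)}\,D(s)\,ds,$$ and, for $a<b$, $\varepsilon>0$ and $u\in H^1(a,b)$ with values in $I$, $$E_\varepsilon[u]:=\int_a^b\left\{\frac{\varepsilon}{2}\,[D(u)u_x]^2+\frac{G(u)}{\varepsilon}\right\}dx.$$ (Functions in $H^1(a,b)$ are identified with their continuous representatives on $[a,b]$.) Let $N\in\mathbb N$ ($N=0$ is allowed), and let $v:[a,b]\to\{\alpha,\beta\}$ be piecewise constant with exactly $N$ jumps, located at $a<h_1<\dots<h_N<b$.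 Let $r>0$ satisfy $h_i+r<h_{i+1}-r$ for $1\le i\le N-1$, and $a\le h_i-r$, $h_i+r\le b$ for $1\le i\le N$. Let $A\in(0,r\sqrt{2\lambda})$ and $C>0$. For all sufficiently small $\varepsilon>0$ let $u_0^\varepsilon\in H^1(a,b)$ be such that $M_1\le u_0^\varepsilon(x)\le M_2$ for all $x\in[a,b]$, for some $M_1<M_2$ with $[M_1,M_2]\subset I$ (which may depend on $\varepsilon$), and such that $$E_\varepsilon[u_0^\varepsilon]\le N\gamma_0+C\exp(-A/\varepsilon).$$ Assume also that $\|u_0^\varepsilon-v\|_{L^1(a,b)}\to0$ as $\varepsilon\to0^+$. For all sufficiently small $\varepsilon>0$ let $u^\varepsilon:[a,b]\times[0,\infty)\to I$ be a global strong solution of $$u_t=\varepsilon^2(D(u)u_x)_x-f(u),\quad x\in(a,b),\ t>0,\qquad u_x(a,t)=u_x(b,t)=0,\quad t>0,\qquad u(x,0)=u_0^\varepsilon(x),\quad x\in[a,b],$$ that is, $u^\varepsilon\in C([0,\infty);H^1(a,b))\cap C((0,\infty);H^2(a,b))\cap C^1((0,\infty);L^2(a,b))$, and the equation holds in $L^2(a,b)$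 at every $t>0$. Then, for every $m>0$, $$\sup_{0\le t\le m\exp(A/\varepsilon)}\|u^\varepsilon(\cdot,t)-v\|_{L^1(a,b)}\longrightarrow0\qquad\text{as }\varepsilon\to0^+.$$ -/

import Mathlib

open Set Filter MeasureTheory
open scoped Topology

noncomputable section

namespace AllenCahn

/-- The spatial derivative of `u` on `[a, b]` (one-sided at the end points). -/
def dx (a b : ℝ) (u : ℝ → ℝ) : ℝ → ℝ := derivWithin u (Icc a b)

/-- The `L^p(a, b)` norm, with values in `[0, ∞]`. -/
def normLp (p : ENNReal) (a b : ℝ) (u : ℝ → ℝ) : ENNReal :=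
  eLpNorm u p (volume.restrict (Ioo a b))

/-- `u ∈ H¹(a, b)`, elements of `H¹(a, b)` being identified with their continuous representatives
on `[a, b]`: `u` is absolutely continuous on `[a, b]` and its derivative, which exists almost
everywhere, is in `L²(a, b)`. -/
def IsH1 (a b : ℝ) (u : ℝ → ℝ) : Prop :=
  AbsolutelyContinuousOnInterval u a b ∧ MemLp (dx a b u) 2 (volume.restrict (Ioo a b))

/-- `u ∈ H²(a, b)`: both `u` and `u_x` are in `H¹(a, b)`. (Such a `u` is `C¹` on `[a, b]`.) -/
def IsH2 (a b : ℝ) (u : ℝ → ℝ) : Prop :=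
  IsH1 a b u ∧ IsH1 a b (dx a b u)

/-- The effective potential `G(u) = ∫_α^u f D`. -/
def potential (f D : ℝ → ℝ) (α u : ℝ) : ℝ := ∫ s in α..u, f s * D s

/-- The energy `E_ε[u] = ∫_a^b (ε/2 [D(u) u_x]² + G(u)/ε) dx`. -/
def energy (f D : ℝ → ℝ) (α a b ε : ℝ) (u : ℝ → ℝ) : ℝ :=
  ∫ x in a..b, (ε / 2 * (D (u x) * dx a b u x) ^ 2 + potential f D α (u x) / ε)

/-- The minimal energy of one transition, `γ₀ = ∫_α^β √(2 G(s)) D(s) ds`. -/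
def gammaZero (f D : ℝ → ℝ) (α β : ℝ) : ℝ :=
  ∫ s in α..β, Real.sqrt (2 * potential f D α s) * D s

/-- `λ = min {f'(α) / D(α), f'(β) / D(β)}`. -/
def lam (f D : ℝ → ℝ) (α β : ℝ) : ℝ := min (deriv f α / D α) (deriv f β / D β)

/-- `v : [a, b] → {α, β}` is piecewise constant with exactly `N` jumps, located at
`h 0 < ⋯ < h (N - 1)`, and the intervals `(h i - r, h i + r)` are contained in `[a, b]` and keep
positive distance from each other. -/
structure IsStep (α β a b : ℝ) (N : ℕ) (h : Fin N → ℝ) (r : ℝ) (v : ℝ → ℝ) : Prop where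
  strictMono : StrictMono h
  mem_Ioo : ∀ i, h i ∈ Ioo a b
  r_pos : 0 < r
  separated : ∀ i j, i < j → h i + r < h j - r
  left_le : ∀ i, a ≤ h i - r
  le_right : ∀ i, h i + r ≤ b
  values : ∀ x ∈ Icc a b, v x = α ∨ v x = β
  const : ∀ x ∈ Icc a b, ∀ y ∈ Icc a b, x ≤ y → (∀ i, h i ∉ Icc x y) → v x = v y
  jump : ∀ i, ∀ x ∈ Icc a b, ∀ y ∈ Icc a b, x < h i → h i < y →
    (∀ j, j ≠ i → h j ∉ Icc x y) → v x ≠ v y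

/-- The `L²(a, b)`-valued map `t ↦ u t` is differentiable at `t` with derivative `w`. -/
def HasL2TimeDeriv (a b : ℝ) (u : ℝ → ℝ → ℝ) (w : ℝ → ℝ) (t : ℝ) : Prop :=
  Tendsto (fun s : ℝ => normLp 2 a b (fun x => (u (t + s) x - u t x) / s - w x)) (𝓝[≠] 0) (𝓝 0)

/-- `u` (where `u t x` is the value at time `t` and position `x`) is a global strong solution of
`u_t = ε² (D(u) u_x)_x - f(u)` on `(a, b)` with values in `I`, homogeneous Neumann boundary
conditions and initial datum `u₀ ∈ H¹(a, b)`: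
`u ∈ C([0, ∞); H¹) ∩ C((0, ∞); H²) ∩ C¹((0, ∞); L²)`, and the equation holds in `L²(a, b)` at every
time `t > 0`. (Continuity of `u_t` in `L²` is a consequence of the equation and of the continuity
in `H²`.) -/
structure IsSolution (I : Set ℝ) (f D : ℝ → ℝ) (a b ε : ℝ) (u₀ : ℝ → ℝ) (u : ℝ → ℝ → ℝ) :
    Prop where
  mem_I : ∀ t, 0 ≤ t → ∀ x ∈ Icc a b, u t x ∈ I
  initial : ∀ x ∈ Icc a b, u 0 x = u₀ x
  memH1 : ∀ t, 0 ≤ t → IsH1 a b (u t)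
  continuous_L2 : ∀ t, 0 ≤ t →
    Tendsto (fun s => normLp 2 a b (fun x => u s x - u t x)) (𝓝[Ici 0] t) (𝓝 0)
  continuous_H1 : ∀ t, 0 ≤ t →
    Tendsto (fun s => normLp 2 a b (fun x => dx a b (u s) x - dx a b (u t) x))
      (𝓝[Ici 0] t) (𝓝 0)
  memH2 : ∀ t, 0 < t → IsH2 a b (u t)
  continuous_H2 : ∀ t, 0 < t →
    Tendsto (fun s => normLp 2 a b
      (fun x => dx a b (dx a b (u s)) x - dx a b (dx a b (u t)) x)) (𝓝 t) (𝓝 0)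
  neumann_left : ∀ t, 0 < t → dx a b (u t) a = 0
  neumann_right : ∀ t, 0 < t → dx a b (u t) b = 0
  equation : ∀ t, 0 < t → HasL2TimeDeriv a b u
    (fun x => ε ^ 2 * dx a b (fun y => D (u t y) * dx a b (u t) y) x - f (u t x)) t

end AllenCahn

end

namespace AllenCahn

/-! Slow motion follows from a rate of dissipation and an exponentially sharp lower bound for the
energy. Along the flow the energy decreases at rate at least `d / ε * ‖u_t‖²` in L², while no
function L¹-close to `v` has energy below `N γ₀ - C₂ e^{-A/ε}` (`exists_energy_lower_bound`). Since
the initial excess is also `O(e^{-A/ε})`, only that much energy can be spent while the solution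
stays near `v`. Young's inequality `‖u_t‖ ≤ η/2 + ‖u_t‖²/(2η)` with `η = √ε e^{-A/ε}` turns this
into an L² displacement `O(√ε)` over a time `m e^{A/ε}` (`norm₂_sub_le`). For small `ε` this is
below the closeness threshold, so a continuity argument closes the estimate.

For the lower bound put `Ψ = geod`. The Modica–Mortola inequality says that the energy on an
interval is at least the variation of `Ψ(u)` between its end points. An L¹-close function is near
different wells at two points `y < h i < w` close to each jump; `[y, w]` pays `γ₀` up to the
`Ψ`-distances from `u y` and `u w` to their wells. These gaps are only small, not exponentially
small, and must be recovered from the rest of `(h i - r, h i + r)`. That is `exists_well_bound`: if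
`u` touches the well or moves a fixed distance away, Modica–Mortola already pays. Otherwise `u`
stays on one side of the well `z`, and `calibration_le` applies to `± (|Ψ(u) - Ψ(z)| - k(x) M
Φ(u)²/2)`, where `Φ(u) = ∫_z^u D` and `k` is a logistic function equal to `1` at the far end and
exponentially small at the near end.

For the dissipation, the gradient energy is a convex quadratic form in `Φ(u)_x`. Hence `E[u(t+s)] -
E[u(t)]` with `s < 0` is bounded below by its first variation (`first_variation_le`), and
integration by parts leaves only difference quotients in L². No spatial regularity of `u_t` is
needed. -/

/-! ### Double-well potential and geodesic distance. -/

/-- The structural assumptions on the reaction term `f` and the diffusivity `D`: the potential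
`∫_α^u f D` is a double well with nondegenerate wells `α < β` of equal depth. -/
structure IsDoubleWell (I : Set ℝ) (f D : ℝ → ℝ) (α β : ℝ) : Prop where
  isOpen : IsOpen I
  ordConnected : I.OrdConnected
  contf : ContinuousOn f I
  contD : ContinuousOn D I
  D_pos : ∀ u ∈ I, 0 < D u
  lt : α < β
  left_mem : α ∈ I
  right_mem : β ∈ I
  f_left : f α = 0
  f_right : f β = 0
  deriv_left : 0 < deriv f α
  deriv_right : 0 < deriv f β
  potential_right : potential f D α β = 0
  potential_pos : ∀ u ∈ I, u ≠ α → u ≠ β → 0 < potential f D α u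

/-- The primitive `Ψ(u) = ∫_α^u √(2 G) D`, the geodesic distance in the Modica–Mortola bound. -/
noncomputable def geod (f D : ℝ → ℝ) (α u : ℝ) : ℝ :=
  ∫ s in α..u, Real.sqrt (2 * potential f D α s) * D s

theorem hasDerivAt_primitive {I : Set ℝ} (hI : IsOpen I) (hc : I.OrdConnected) {g : ℝ → ℝ}
    (hg : ContinuousOn g I) {z u : ℝ} (hz : z ∈ I) (hu : u ∈ I) :
    HasDerivAt (fun u => ∫ s in z..u, g s) (g u) u := by
  refine intervalIntegral.integral_hasDerivAt_right ?_ ?_ (hg.continuousAt (hI.mem_nhds hu))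
  · exact (hg.mono (hc.uIcc_subset hz hu)).intervalIntegrable
  · exact hg.stronglyMeasurableAtFilter hI u hu

/-- By the mean value theorem `g` decreases to the left of `z` and increases to the right. This
handles both sides of a well at once. -/
theorem nonneg_of_sub_mul_deriv_nonneg {g g' : ℝ → ℝ} {z ρ : ℝ} (hz : 0 ≤ g z)
    (hd : ∀ x, |x - z| < ρ → HasDerivAt g (g' x) x)
    (hs : ∀ x, |x - z| < ρ → 0 ≤ (x - z) * g' x) {u : ℝ} (hu : |u - z| < ρ) : 0 ≤ g u := by
  rw [abs_lt] at hu
  rcases lt_trichotomy u z with h | h | h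
  · obtain ⟨c, hc, e⟩ := exists_hasDerivAt_eq_slope g g' h
      (fun x hx => (hd x (abs_lt.2 ⟨by linarith [hx.1], by linarith [hx.2]⟩)).continuousAt.continuousWithinAt)
      (fun x hx => hd x (abs_lt.2 ⟨by linarith [hx.1], by linarith [hx.2]⟩))
    have h1 := hs c (abs_lt.2 ⟨by linarith [hc.1], by linarith [hc.2]⟩)
    have h2 : g' c ≤ 0 := by
      by_contra h3
      nlinarith [mul_pos (sub_pos.2 hc.2) (not_le.1 h3)]
    rw [e, div_le_iff₀ (by linarith)] at h2
    linarith
  · rwa [h]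
  · obtain ⟨c, hc, e⟩ := exists_hasDerivAt_eq_slope g g' h
      (fun x hx => (hd x (abs_lt.2 ⟨by linarith [hx.1], by linarith [hx.2]⟩)).continuousAt.continuousWithinAt)
      (fun x hx => hd x (abs_lt.2 ⟨by linarith [hx.1], by linarith [hx.2]⟩))
    have h1 := hs c (abs_lt.2 ⟨by linarith [hc.1], by linarith [hc.2]⟩)
    have h2 : 0 ≤ g' c := by
      by_contra h3
      nlinarith [mul_pos (sub_pos.2 hc.1) (neg_pos.2 (not_le.1 h3))]
    rw [e, le_div_iff₀ (by linarith)] at h2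
    linarith

theorem eventually_sub_mul_nonneg {g : ℝ → ℝ} {g' z : ℝ} (hg : HasDerivAt g g' z)
    (hz : g z = 0) (hpos : 0 < g') : ∀ᶠ u in 𝓝 z, 0 ≤ (u - z) * g u := by
  have h1 := (hasDerivAt_iff_tendsto_slope.1 hg).eventually (lt_mem_nhds hpos)
  rw [eventually_nhdsWithin_iff] at h1
  filter_upwards [h1] with u hu
  rcases eq_or_ne u z with h | h
  · simp [h]
  · have h2 := hu h
    rw [slope_def_field, hz, sub_zero] at h2
    have h3 : (u - z) * g u = (u - z) ^ 2 * (g u / (u - z)) := by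
      field_simp [sub_ne_zero.2 h]
    rw [h3]
    positivity

theorem potential_self (f D : ℝ → ℝ) (α : ℝ) : potential f D α α = 0 := by simp [potential]

namespace IsDoubleWell

variable {I : Set ℝ} {f D : ℝ → ℝ} {α β : ℝ} (W : IsDoubleWell I f D α β)
include W

theorem contfD : ContinuousOn (fun s => f s * D s) I := W.contf.mul W.contD

theorem hasDerivAt_potential {u : ℝ} (hu : u ∈ I) :
    HasDerivAt (potential f D α) (f u * D u) u :=
  hasDerivAt_primitive W.isOpen W.ordConnected W.contfD W.left_mem hu

theorem contG : ContinuousOn (potential f D α) I := fun _ hu =>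
  (W.hasDerivAt_potential hu).continuousAt.continuousWithinAt

theorem cont_sqrt : ContinuousOn (fun u => Real.sqrt (2 * potential f D α u)) I :=
  (continuousOn_const.mul W.contG).sqrt

theorem cont_sqrt_mul : ContinuousOn (fun u => Real.sqrt (2 * potential f D α u) * D u) I :=
  W.cont_sqrt.mul W.contD

theorem potential_nonneg {u : ℝ} (hu : u ∈ I) : 0 ≤ potential f D α u := by
  by_cases h1 : u = α
  · rw [h1, potential_self]
  by_cases h2 : u = β
  · rw [h2, W.potential_right]
  exact (W.potential_pos u hu h1 h2).le

theorem hasDerivAt_geod {u : ℝ} (hu : u ∈ I) :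
    HasDerivAt (geod f D α) (Real.sqrt (2 * potential f D α u) * D u) u :=
  hasDerivAt_primitive W.isOpen W.ordConnected W.cont_sqrt_mul W.left_mem hu

theorem hasDerivAt_integral_D {z u : ℝ} (hz : z ∈ I) (hu : u ∈ I) :
    HasDerivAt (fun u => ∫ s in z..u, D s) (D u) u :=
  hasDerivAt_primitive W.isOpen W.ordConnected W.contD hz hu

theorem geod_monotoneOn : MonotoneOn (geod f D α) I := by
  refine monotoneOn_of_deriv_nonneg W.ordConnected.convex
    (fun u hu => (W.hasDerivAt_geod hu).continuousAt.continuousWithinAt)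
    (fun u hu => (W.hasDerivAt_geod (interior_subset hu)).differentiableAt.differentiableWithinAt) ?_
  intro u hu
  rw [(W.hasDerivAt_geod (interior_subset hu)).deriv]
  exact mul_nonneg (Real.sqrt_nonneg _) (W.D_pos u (interior_subset hu)).le

/-- `Ψ` increases strictly across every interval that contains no well in its interior. -/
theorem geod_lt {p q : ℝ} (hp : p ∈ I) (hq : q ∈ I) (hpq : p < q)
    (hw : ∀ u ∈ Ioo p q, u ≠ α ∧ u ≠ β) : geod f D α p < geod f D α q := by
  have hsub : Icc p q ⊆ I := W.ordConnected.out hp hq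
  refine strictMonoOn_of_deriv_pos (convex_Icc p q)
    (fun u hu => (W.hasDerivAt_geod (hsub hu)).continuousAt.continuousWithinAt) ?_
    (left_mem_Icc.2 hpq.le) (right_mem_Icc.2 hpq.le) hpq
  intro u hu
  rw [interior_Icc] at hu
  have huI := hsub (Ioo_subset_Icc_self hu)
  rw [(W.hasDerivAt_geod huI).deriv]
  exact mul_pos (Real.sqrt_pos.2 (mul_pos two_pos (W.potential_pos u huI (hw u hu).1 (hw u hu).2)))
    (W.D_pos u huI)

theorem mem_of_well {z : ℝ} (hz : z = α ∨ z = β) : z ∈ I := by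
  rcases hz with rfl | rfl
  exacts [W.left_mem, W.right_mem]

theorem f_well {z : ℝ} (hz : z = α ∨ z = β) : f z = 0 := by
  rcases hz with rfl | rfl
  exacts [W.f_left, W.f_right]

theorem potential_well {z : ℝ} (hz : z = α ∨ z = β) : potential f D α z = 0 := by
  rcases hz with rfl | rfl
  exacts [potential_self _ _ _, W.potential_right]

theorem deriv_well {z : ℝ} (hz : z = α ∨ z = β) : 0 < deriv f z := by
  rcases hz with rfl | rfl
  exacts [W.deriv_left, W.deriv_right]

theorem hasDerivAt_sub_well {z : ℝ} (hz : z = α ∨ z = β) (c : ℝ) :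
    HasDerivAt (fun u => f u - c * ∫ s in z..u, D s) (deriv f z - c * D z) z := by
  -- `deriv` is `0` where `f` is not differentiable, so its positivity at a well already gives
  -- differentiability.
  have hd : DifferentiableAt ℝ f z := by
    by_contra h
    exact (W.deriv_well hz).ne' (deriv_zero_of_not_differentiableAt h)
  exact hd.hasDerivAt.sub
    ((W.hasDerivAt_integral_D (W.mem_of_well hz) (W.mem_of_well hz)).const_mul c)

/-- The factor `D u` splits off, so the sign of the derivative is that of `f - c Φ`, which vanishes
at a well `z` with slope `f'(z) - c D(z)`. This is why `f'(z) / D(z)` is the critical constant. -/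
theorem hasDerivAt_potential_sub {z u : ℝ} (hz : z ∈ I) (hu : u ∈ I) (c : ℝ) :
    HasDerivAt (fun u => 2 * potential f D α u - c * (∫ s in z..u, D s) ^ 2)
      (2 * D u * (f u - c * ∫ s in z..u, D s)) u := by
  refine (((W.hasDerivAt_potential hu).const_mul 2).sub
    (((W.hasDerivAt_integral_D hz hu).pow 2).const_mul c)).congr_deriv ?_
  simp
  ring

/-- Near a well, `2 G` is squeezed between multiples of `Φ²`, where `Φ(u) = ∫_z^u D`. -/
theorem exists_potential_bounds {z c₁ c₂ : ℝ} (hz : z = α ∨ z = β) (h₁ : c₁ < deriv f z / D z)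
    (h₂ : deriv f z / D z < c₂) : ∃ ρ > 0, ∀ u, |u - z| < ρ → u ∈ I ∧
      c₁ * (∫ s in z..u, D s) ^ 2 ≤ 2 * potential f D α u ∧
      2 * potential f D α u ≤ c₂ * (∫ s in z..u, D s) ^ 2 := by
  have hzI := W.mem_of_well hz
  have hD := W.D_pos z hzI
  have e1 := eventually_sub_mul_nonneg (W.hasDerivAt_sub_well hz c₁) (by simp [W.f_well hz])
    (by rw [lt_div_iff₀ hD] at h₁; linarith)
  have e2 := eventually_sub_mul_nonneg (W.hasDerivAt_sub_well hz c₂).neg (by simp [W.f_well hz])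
    (by rw [div_lt_iff₀ hD] at h₂; linarith)
  obtain ⟨ρ, hρ, h⟩ := Metric.eventually_nhds_iff.1
    ((e1.and e2).and (W.isOpen.mem_nhds hzI : ∀ᶠ u in 𝓝 z, u ∈ I))
  simp only [Real.dist_eq] at h
  refine ⟨ρ, hρ, fun u hu => ⟨(h hu).2, ?_, ?_⟩⟩
  · have := nonneg_of_sub_mul_deriv_nonneg (z := z) (ρ := ρ) (by simp [W.potential_well hz])
      (fun x hx => W.hasDerivAt_potential_sub hzI (h hx).2 c₁) (fun x hx => ?_) hu
    · linarith
    · have := mul_nonneg (W.D_pos x (h hx).2).le (h hx).1.1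
      linarith
  · have := nonneg_of_sub_mul_deriv_nonneg (z := z) (ρ := ρ) (by simp [W.potential_well hz])
      (fun x hx => (W.hasDerivAt_potential_sub hzI (h hx).2 c₂).neg) (fun x hx => ?_) hu
    · simp at this
      linarith
    · have := mul_nonneg (W.D_pos x (h hx).2).le (h hx).1.2
      simp at this
      linarith

theorem integral_D_sign {z u : ℝ} (hz : z ∈ I) (hu : u ∈ I) :
    0 ≤ (u - z) * ∫ s in z..u, D s := by
  have hm : ∀ p ∈ I, ∀ q ∈ I, p ≤ q → 0 ≤ ∫ s in p..q, D s := fun p hp q hq hpq =>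
    intervalIntegral.integral_nonneg hpq
      fun s hs => (W.D_pos s (W.ordConnected.out hp hq hs)).le
  rcases le_total z u with h | h
  · exact mul_nonneg (by linarith) (hm z hz u hu h)
  · rw [intervalIntegral.integral_symm]
    have := hm u hu z hz h
    nlinarith

/-- Compare derivatives: `Ψ' = √(2G) D` is at most `M |Φ| D`, which is the absolute value of the
derivative of `M Φ² / 2`, and both sides vanish at `z`. -/
theorem abs_geod_sub_le {z M ρ : ℝ} (hz : z ∈ I) (hM : 0 < M)
    (h : ∀ u, |u - z| < ρ → u ∈ I ∧ 2 * potential f D α u ≤ M ^ 2 * (∫ s in z..u, D s) ^ 2)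
    {u : ℝ} (hu : |u - z| < ρ) :
    |geod f D α u - geod f D α z| ≤ M * (∫ s in z..u, D s) ^ 2 / 2 := by
  have hs : ∀ x, |x - z| < ρ →
      Real.sqrt (2 * potential f D α x) ≤ M * |∫ s in z..x, D s| := fun x hx => by
    refine Real.sqrt_le_iff.2 ⟨by positivity, ?_⟩
    rw [mul_pow, sq_abs]
    exact (h x hx).2
  have key : ∀ s : ℝ, |s| = 1 → 0 ≤ M * (∫ s in z..u, D s) ^ 2 / 2 -
      s * (geod f D α u - geod f D α z) := by
    intro s hs1
    refine nonneg_of_sub_mul_deriv_nonneg (z := z) (ρ := ρ)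
      (g := fun u => M * (∫ s in z..u, D s) ^ 2 / 2 - s * (geod f D α u - geod f D α z))
      (g' := fun x => D x * (M * (∫ s in z..x, D s) - s * Real.sqrt (2 * potential f D α x)))
      (by simp) (fun x hx => ?_) (fun x hx => ?_) hu
    · refine ((((W.hasDerivAt_integral_D hz (h x hx).1).pow 2).const_mul M).div_const 2 |>.sub
        (((W.hasDerivAt_geod (h x hx).1).sub_const _).const_mul s)).congr_deriv ?_
      simp
      ring
    · have h1 := W.integral_D_sign hz (h x hx).1
      have h2 := hs x hx
      have h3 : (x - z) * (s * Real.sqrt (2 * potential f D α x)) ≤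
          |x - z| * (M * |∫ s in z..x, D s|) := by
        calc _ ≤ |(x - z) * (s * Real.sqrt (2 * potential f D α x))| := le_abs_self _
          _ = |x - z| * Real.sqrt (2 * potential f D α x) := by
            rw [abs_mul, abs_mul, hs1, abs_of_nonneg (Real.sqrt_nonneg _), one_mul]
          _ ≤ _ := by gcongr
      have h4 : |x - z| * (M * |∫ s in z..x, D s|) = M * ((x - z) * ∫ s in z..x, D s) := by
        rw [← abs_of_nonneg h1, abs_mul]
        ring
      have h5 := mul_nonneg (W.D_pos x (h x hx).1).le (sub_nonneg.2 (h3.trans h4.le))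
      linarith
  have h1 := key 1 (by simp)
  have h2 := key (-1) (by simp)
  exact abs_le.2 ⟨by linarith, by linarith⟩

/-- `Ψ` is strictly monotone on a short interval on each side of the well; monotonicity on all of
`I` carries the gap further out. -/
theorem exists_abs_geod_sub_ge {z ρ : ℝ} (hz : z = α ∨ z = β) (hρ : 0 < ρ) :
    ∃ m > 0, ∀ u ∈ I, ρ ≤ |u - z| → m ≤ |geod f D α u - geod f D α z| := by
  have hzI := W.mem_of_well hz
  obtain ⟨σ, hσ, hball⟩ := Metric.isOpen_iff.1 W.isOpen z hzI
  -- The bound `κ ≤ β - α` keeps the other well out of the interior of the two test intervals.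
  obtain ⟨κ, hκ, hκσ, hκρ, hκβ⟩ : ∃ κ > 0, κ < σ ∧ κ ≤ ρ ∧ κ ≤ β - α :=
    ⟨min (σ / 2) (min ρ (β - α)),
      lt_min (by linarith) (lt_min hρ (by linarith [W.lt])),
      (min_le_left _ _).trans_lt (by linarith), (min_le_right _ _).trans (min_le_left _ _),
      (min_le_right _ _).trans (min_le_right _ _)⟩
  have hr : z + κ ∈ I := hball (by simp [abs_of_pos hκ, hκσ])
  have hl : z - κ ∈ I := hball (by simp [abs_of_pos hκ, hκσ])
  have g1 : geod f D α z < geod f D α (z + κ) := by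
    refine W.geod_lt hzI hr (by linarith) fun u hu => ?_
    rcases hz with rfl | rfl
    · exact ⟨hu.1.ne', by linarith [hu.2] |> fun h : u < β => h.ne⟩
    · exact ⟨by linarith [hu.1, W.lt] |> fun h : α < u => h.ne', hu.1.ne'⟩
  have g2 : geod f D α (z - κ) < geod f D α z := by
    refine W.geod_lt hl hzI (by linarith) fun u hu => ?_
    rcases hz with rfl | rfl
    · exact ⟨hu.2.ne, by linarith [hu.2, W.lt] |> fun h : u < β => h.ne⟩
    · exact ⟨by linarith [hu.1] |> fun h : α < u => h.ne', hu.2.ne⟩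
  refine ⟨min (geod f D α (z + κ) - geod f D α z) (geod f D α z - geod f D α (z - κ)),
    lt_min (by linarith) (by linarith), fun u hu hρu => ?_⟩
  rcases le_abs.1 hρu with h | h
  · have := W.geod_monotoneOn hr hu (by linarith)
    exact (min_le_left _ _).trans (le_trans (by linarith) (le_abs_self _))
  · have := W.geod_monotoneOn hu hl (by linarith)
    exact (min_le_right _ _).trans (le_trans (by linarith) (neg_le_abs _))

end IsDoubleWell

/-! ### Absolute continuity and almost everywhere derivatives. -/

theorem _root_.LipschitzOnWith.comp_absolutelyContinuousOnInterval {Θ u : ℝ → ℝ} {K : NNReal}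
    {s : Set ℝ} {a b : ℝ} (hΘ : LipschitzOnWith K Θ s) (hu : AbsolutelyContinuousOnInterval u a b)
    (hs : MapsTo u (uIcc a b) s) : AbsolutelyContinuousOnInterval (fun x => Θ (u x)) a b := by
  rw [absolutelyContinuousOnInterval_iff] at hu ⊢
  intro ε hε
  obtain ⟨δ, hδ, h⟩ := hu (ε / (K + 1)) (by positivity)
  refine ⟨δ, hδ, fun E hE hlt => ?_⟩
  have h1 := h E hE hlt
  calc ∑ i ∈ Finset.range E.1, dist (Θ (u (E.2 i).1)) (Θ (u (E.2 i).2))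
      ≤ ∑ i ∈ Finset.range E.1, (K + 1) * dist (u (E.2 i).1) (u (E.2 i).2) := by
        refine Finset.sum_le_sum fun i hi => ?_
        have hm := hE.1 i hi
        refine (hΘ.dist_le_mul _ (hs hm.1) _ (hs hm.2)).trans ?_
        gcongr
        simp
    _ = (K + 1) * ∑ i ∈ Finset.range E.1, dist (u (E.2 i).1) (u (E.2 i).2) := by
        rw [Finset.mul_sum]
    _ < ε := by rwa [lt_div_iff₀' (by positivity)] at h1

theorem exists_range_subset {I : Set ℝ} {a b : ℝ} (hab : a ≤ b) {u : ℝ → ℝ}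
    (hu : ContinuousOn u (Icc a b)) (hI : MapsTo u (Icc a b) I) :
    ∃ m M, m ∈ I ∧ M ∈ I ∧ MapsTo u (Icc a b) (Icc m M) := by
  obtain ⟨x, hx, hmin⟩ := isCompact_Icc.exists_isMinOn (nonempty_Icc.2 hab) hu
  obtain ⟨y, hy, hmax⟩ := isCompact_Icc.exists_isMaxOn (nonempty_Icc.2 hab) hu
  exact ⟨u x, u y, hI hx, hI hy, fun z hz => ⟨hmin hz, hmax hz⟩⟩

/-- The range of `u` is compact in `I`, so it lies in a closed interval on which `Θ` is Lipschitz.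
-/
theorem comp_absolutelyContinuous {I : Set ℝ} (hc : I.OrdConnected) {Θ θ u : ℝ → ℝ} {a b : ℝ}
    (hab : a ≤ b) (hΘ : ∀ y ∈ I, HasDerivAt Θ (θ y) y) (hθ : ContinuousOn θ I)
    (hu : AbsolutelyContinuousOnInterval u a b) (hI : MapsTo u (Icc a b) I) :
    AbsolutelyContinuousOnInterval (fun x => Θ (u x)) a b := by
  have hcont := hu.continuousOn
  rw [uIcc_of_le hab] at hcont
  obtain ⟨m, M, hm, hM, hmap⟩ := exists_range_subset hab hcont hI
  have hsub : Icc m M ⊆ I := hc.out hm hM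
  obtain ⟨K, hK⟩ := isCompact_Icc.exists_bound_of_continuousOn (hθ.mono hsub)
  have hL : LipschitzOnWith K.toNNReal Θ (Icc m M) :=
    (convex_Icc m M).lipschitzOnWith_of_nnnorm_hasDerivWithin_le
      (fun x hx => (hΘ x (hsub hx)).hasDerivWithinAt)
      (fun x hx => by
        rw [← NNReal.coe_le_coe]
        exact (hK x hx).trans (Real.le_coe_toNNReal K))
  exact hL.comp_absolutelyContinuousOnInterval hu (by rwa [uIcc_of_le hab])

theorem dx_eq_deriv {a b x : ℝ} (hx : x ∈ Ioo a b) (u : ℝ → ℝ) : dx a b u x = deriv u x :=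
  derivWithin_of_mem_nhds (Icc_mem_nhds hx.1 hx.2)

theorem dx_congr {a b : ℝ} {u w : ℝ → ℝ} (h : EqOn u w (Icc a b)) {x : ℝ} (hx : x ∈ Icc a b) :
    dx a b u x = dx a b w x := derivWithin_congr h (h hx)

theorem aestronglyMeasurable_dx (a b : ℝ) (u : ℝ → ℝ) :
    AEStronglyMeasurable (dx a b u) (volume.restrict (Ioo a b)) := by
  refine (measurable_deriv u).aestronglyMeasurable.congr ?_
  filter_upwards [ae_restrict_mem measurableSet_Ioo] with x hx
  rw [dx_eq_deriv hx]

theorem ae_hasDerivAt_of_absolutelyContinuous {u : ℝ → ℝ} {a b : ℝ} (hab : a ≤ b)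
    (hu : AbsolutelyContinuousOnInterval u a b) :
    ∀ᵐ x ∂(volume.restrict (Ioo a b)), HasDerivAt u (dx a b u x) x := by
  rw [ae_restrict_iff' measurableSet_Ioo]
  filter_upwards [hu.ae_differentiableAt] with x hx hxI
  rw [dx_eq_deriv hxI]
  exact (hx (by rw [uIcc_of_le hab]; exact Ioo_subset_Icc_self hxI)).hasDerivAt

theorem _root_.ContinuousOn.memLp_top_Ioo {g : ℝ → ℝ} {a b : ℝ} (hg : ContinuousOn g (Icc a b)) :
    MemLp g ⊤ (volume.restrict (Ioo a b)) := by
  obtain ⟨K, hK⟩ := isCompact_Icc.exists_bound_of_continuousOn hg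
  refine memLp_top_of_bound
    ((hg.mono Ioo_subset_Icc_self).aestronglyMeasurable measurableSet_Ioo) K ?_
  filter_upwards [ae_restrict_mem measurableSet_Ioo] with x hx
  exact hK x (Ioo_subset_Icc_self hx)

/-! ### Energy density and the Modica–Mortola inequality. -/

/-- The energy density. -/
noncomputable def density (f D : ℝ → ℝ) (α a b ε : ℝ) (u : ℝ → ℝ) (x : ℝ) : ℝ :=
  ε / 2 * (D (u x) * dx a b u x) ^ 2 + potential f D α (u x) / ε

theorem IsH1.continuousOn {a b : ℝ} (hab : a ≤ b) {u : ℝ → ℝ} (hu : IsH1 a b u) :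
    ContinuousOn u (Icc a b) := by
  have := hu.1.continuousOn
  rwa [uIcc_of_le hab] at this

namespace IsDoubleWell

variable {I : Set ℝ} {f D : ℝ → ℝ} {α β : ℝ} (W : IsDoubleWell I f D α β)
include W

theorem memLp_flux {a b : ℝ} (hab : a ≤ b) {u : ℝ → ℝ} (hu : IsH1 a b u)
    (hI : MapsTo u (Icc a b) I) :
    MemLp (fun x => D (u x) * dx a b u x) 2 (volume.restrict (Ioo a b)) :=
  hu.2.mul (W.contD.comp (hu.continuousOn hab) hI).memLp_top_Ioo

theorem integrable_density {a b : ℝ} (hab : a ≤ b) (ε : ℝ) {u : ℝ → ℝ} (hu : IsH1 a b u)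
    (hI : MapsTo u (Icc a b) I) :
    IntegrableOn (density f D α a b ε u) (Ioo a b) := by
  refine ((W.memLp_flux hab hu hI).integrable_sq.const_mul _).add (Integrable.div_const ?_ _)
  exact (memLp_one_iff_integrable.1
    ((W.contG.comp (hu.continuousOn hab) hI).memLp_top_Ioo.mono_exponent le_top))

theorem density_nonneg {a b ε : ℝ} (hε : 0 < ε) {u : ℝ → ℝ} (hI : MapsTo u (Icc a b) I)
    {x : ℝ} (hx : x ∈ Icc a b) : 0 ≤ density f D α a b ε u x := by
  have := W.potential_nonneg (hI hx)
  unfold density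
  positivity

/-- If the density dominates `-F'`, then the energy dominates the decrease of `F`. -/
theorem sub_le_integral_density {a b ε p q : ℝ} {u F : ℝ → ℝ} (hu : IsH1 a b u)
    (hI : MapsTo u (Icc a b) I) (hpq : p ≤ q) (hap : a ≤ p) (hqb : q ≤ b)
    (hF : AbsolutelyContinuousOnInterval F p q)
    (h : ∀ᵐ x, x ∈ Ioo p q → ∀ F', HasDerivAt F F' x → -F' ≤ density f D α a b ε u x) :
    F p - F q ≤ ∫ x in Ioo p q, density f D α a b ε u x := by
  have h1 := hF.integral_deriv_eq_sub
  have h2 : F p - F q = ∫ x in Ioo p q, -deriv F x := by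
    rw [integral_neg, ← integral_Ioc_eq_integral_Ioo, ← intervalIntegral.integral_of_le hpq, h1]
    ring
  rw [h2]
  have hint := hF.intervalIntegrable_deriv
  rw [intervalIntegrable_iff_integrableOn_Ioo_of_le hpq] at hint
  refine integral_mono_ae hint.neg ((W.integrable_density (by linarith) ε hu hI).mono_set
    (Ioo_subset_Ioo hap hqb)) ?_
  rw [EventuallyLE, ae_restrict_iff' measurableSet_Ioo]
  filter_upwards [h, hF.ae_differentiableAt] with x hx hd hxI
  exact hx hxI _ (hd (by rw [uIcc_of_le hpq]; exact Ioo_subset_Icc_self hxI)).hasDerivAt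

/-- The Modica–Mortola inequality. -/
theorem abs_geod_sub_le_integral {a b ε p q : ℝ} (hε : 0 < ε) {u : ℝ → ℝ} (hu : IsH1 a b u)
    (hI : MapsTo u (Icc a b) I) (hpq : p ≤ q) (hap : a ≤ p) (hqb : q ≤ b) :
    |geod f D α (u q) - geod f D α (u p)| ≤ ∫ x in Ioo p q, density f D α a b ε u x := by
  have hsub : Icc p q ⊆ Icc a b := Icc_subset_Icc hap hqb
  have hab : a ≤ b := by linarith
  have hac : AbsolutelyContinuousOnInterval (fun x => geod f D α (u x)) p q :=
    comp_absolutelyContinuous W.ordConnected hpq (fun y hy => W.hasDerivAt_geod hy)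
      W.cont_sqrt_mul (hu.1.mono (by rwa [uIcc_of_le hpq, uIcc_of_le hab])) (hI.mono_left hsub)
  have key : ∀ s : ℝ, s ^ 2 = 1 → s * geod f D α (u p) - s * geod f D α (u q) ≤
      ∫ x in Ioo p q, density f D α a b ε u x := by
    intro s hs
    refine W.sub_le_integral_density (F := fun x => s * geod f D α (u x)) hu hI hpq hap hqb
      (hac.const_mul s) ?_
    have hder := ae_hasDerivAt_of_absolutelyContinuous hab hu.1
    rw [ae_restrict_iff' measurableSet_Ioo] at hder
    filter_upwards [hder] with x hx hxI F' hF'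
    have hxab : x ∈ Ioo a b := Ioo_subset_Ioo hap hqb hxI
    have hxI' := hI (Ioo_subset_Icc_self hxab)
    have h1 := ((W.hasDerivAt_geod hxI').comp x (hx hxab)).const_mul s
    rw [hF'.unique h1, density]
    set X := dx a b u x
    have h2 := Real.sq_sqrt (mul_nonneg two_pos.le (W.potential_nonneg hxI'))
    set ψ := Real.sqrt (2 * potential f D α (u x))
    have h3 : potential f D α (u x) = ψ ^ 2 / 2 := by linarith
    rw [h3]
    -- Completing the square is the whole inequality; the sign `s` gives both halves of the absolute
    -- value.
    have h4 : 0 ≤ (ε * (D (u x) * X) + s * ψ) ^ 2 / (2 * ε) := by positivity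
    have h5 : (ε * (D (u x) * X) + s * ψ) ^ 2 / (2 * ε) = ε / 2 * (D (u x) * X) ^ 2 +
        s ^ 2 * ψ ^ 2 / 2 / ε + s * (ψ * D (u x) * X) := by field_simp; ring
    rw [h5, hs, one_mul] at h4
    linarith
  have h1 := key 1 (by norm_num)
  have h2 := key (-1) (by norm_num)
  exact abs_le.2 ⟨by linarith, by linarith⟩

end IsDoubleWell

/-! ### Logistic calibration near a well. -/

/-- The explicit solution of the logistic equation that drives the calibration. -/
noncomputable def logistic (μ M ε τ y x : ℝ) : ℝ :=
  2 * μ / (M + (2 * μ - M) * Real.exp (2 * μ * (τ * (y - x)) / ε))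

theorem logistic_denom_pos {μ M : ℝ} (hM : 0 < M) (hμ : M < 2 * μ) (t : ℝ) :
    0 < M + (2 * μ - M) * Real.exp t := by
  have : 0 < 2 * μ - M := by linarith
  positivity

/-- In `calibration_le` the quadratic term of this equation cancels the `k²` left over from
completing the square, and the linear term produces exponential decay at rate `2μ/ε`. -/
theorem hasDerivAt_logistic {μ M ε τ y : ℝ} (hM : 0 < M) (hμ : M < 2 * μ) (x : ℝ) :
    HasDerivAt (logistic μ M ε τ y) (τ * logistic μ M ε τ y x *
      (2 * μ - M * logistic μ M ε τ y x) / ε) x := by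
  have hp := logistic_denom_pos hM hμ (2 * μ * (τ * (y - x)) / ε)
  have h1 : HasDerivAt (fun x => 2 * μ * (τ * (y - x)) / ε) (2 * μ * (τ * (-1)) / ε) x :=
    ((((hasDerivAt_id x).const_sub y).const_mul τ).const_mul (2 * μ)).div_const ε
  refine ((hasDerivAt_const x (2 * μ)).div ((h1.exp.const_mul (2 * μ - M)).const_add M)
    hp.ne').congr_deriv ?_
  unfold logistic
  generalize Real.exp (2 * μ * (τ * (y - x)) / ε) = e at *
  field_simp
  ring

theorem logistic_nonneg {μ M ε τ y x : ℝ} (hM : 0 < M) (hμ : M < 2 * μ) :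
    0 ≤ logistic μ M ε τ y x :=
  div_nonneg (by linarith) (logistic_denom_pos hM hμ _).le

theorem logistic_self {μ M ε τ y : ℝ} (hμ : 0 < μ) : logistic μ M ε τ y y = 1 := by
  simp [logistic, hμ.ne']

theorem logistic_le {μ M ε τ y x : ℝ} (hM : 0 < M) (hμ : M < 2 * μ) :
    logistic μ M ε τ y x ≤ 2 * μ / (2 * μ - M) * Real.exp (-(2 * μ * (τ * (y - x)) / ε)) := by
  have hB : 0 < 2 * μ - M := by linarith
  rw [Real.exp_neg, ← div_eq_mul_inv, div_div, logistic]
  gcongr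
  · linarith
  · linarith

theorem contDiff_logistic {μ M ε τ y : ℝ} (hM : 0 < M) (hμ : M < 2 * μ) :
    ContDiff ℝ 1 (logistic μ M ε τ y) := by
  unfold logistic
  exact contDiff_const.div (by fun_prop) fun x => (logistic_denom_pos hM hμ _).ne'

namespace IsDoubleWell

variable {I : Set ℝ} {f D : ℝ → ℝ} {α β : ℝ} (W : IsDoubleWell I f D α β)
include W

/-- The calibration estimate on an interval on which `u` stays strictly on one side of the well. -/
theorem calibration_le {a b ε p q z μ M ρ s τ y : ℝ} (hε : 0 < ε) (hz : z ∈ I) (hM : 0 < M)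
    (hμ : M < 2 * μ) (hs : s ^ 2 = 1) (hτ : τ ^ 2 = 1)
    (hρ : ∀ w, |w - z| < ρ →
      μ ^ 2 * (∫ s in z..w, D s) ^ 2 ≤ 2 * potential f D α w)
    {u : ℝ → ℝ} (hu : IsH1 a b u)
    (hI : MapsTo u (Icc a b) I) (hpq : p ≤ q) (hap : a ≤ p) (hqb : q ≤ b)
    (hside : ∀ x ∈ Icc p q, |u x - z| < ρ ∧ 0 < s * (u x - z)) :
    τ * (s * (geod f D α (u p) - geod f D α z) -
        logistic μ M ε τ y p * (M * (∫ s in z..u p, D s) ^ 2 / 2)) -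
      τ * (s * (geod f D α (u q) - geod f D α z) -
        logistic μ M ε τ y q * (M * (∫ s in z..u q, D s) ^ 2 / 2)) ≤
      ∫ x in Ioo p q, density f D α a b ε u x := by
  have hsub : Icc p q ⊆ Icc a b := Icc_subset_Icc hap hqb
  have hab : a ≤ b := by linarith
  have hup := hu.1.mono (c := p) (d := q) (by rwa [uIcc_of_le hpq, uIcc_of_le hab])
  have hD2 : ∀ w ∈ I, HasDerivAt (fun w => M * (∫ s in z..w, D s) ^ 2 / 2)
      (M * (∫ s in z..w, D s) * D w) w := fun w hw => by
    refine ((((W.hasDerivAt_integral_D hz hw).pow 2).const_mul M).div_const 2).congr_deriv ?_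
    simp
    ring
  have hΦc : ContinuousOn (fun w => ∫ s in z..w, D s) I := fun w hw =>
    (W.hasDerivAt_integral_D hz hw).continuousAt.continuousWithinAt
  have hac1 : AbsolutelyContinuousOnInterval (fun x => s * (geod f D α (u x) - geod f D α z)) p q :=
    comp_absolutelyContinuous (Θ := fun w => s * (geod f D α w - geod f D α z)) W.ordConnected hpq
      (fun w hw => ((W.hasDerivAt_geod hw).sub_const (geod f D α z)).const_mul s)
      (continuousOn_const.mul W.cont_sqrt_mul) hup (hI.mono_left hsub)
  have hac2 : AbsolutelyContinuousOnInterval (fun x => M * (∫ s in z..u x, D s) ^ 2 / 2) p q :=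
    comp_absolutelyContinuous (Θ := fun w => M * (∫ s in z..w, D s) ^ 2 / 2) W.ordConnected hpq hD2
      ((continuousOn_const.mul hΦc).mul W.contD) hup (hI.mono_left hsub)
  have hac3 : AbsolutelyContinuousOnInterval (logistic μ M ε τ y) p q :=
    (contDiff_logistic hM hμ).contDiffOn.absolutelyContinuousOnInterval
  refine W.sub_le_integral_density (F := fun x => τ * (s * (geod f D α (u x) - geod f D α z) -
    logistic μ M ε τ y x * (M * (∫ s in z..u x, D s) ^ 2 / 2))) hu hI hpq hap hqb
    ((hac1.fun_sub (hac3.fun_mul hac2)).const_mul τ) ?_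
  have hder := ae_hasDerivAt_of_absolutelyContinuous hab hu.1
  rw [ae_restrict_iff' measurableSet_Ioo] at hder
  filter_upwards [hder] with x hx hxI F' hF'
  have hxab : x ∈ Ioo a b := Ioo_subset_Ioo hap hqb hxI
  have hxI' := hI (Ioo_subset_Icc_self hxab)
  have hd := hx hxab
  have h1 := ((((((W.hasDerivAt_geod hxI').comp x hd).sub_const (geod f D α z)).const_mul s).sub
    ((hasDerivAt_logistic (ε := ε) (τ := τ) (y := y) hM hμ x).mul
      ((hD2 (u x) hxI').comp x hd))).const_mul τ)
  rw [hF'.unique h1, density]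
  obtain ⟨hlt, hsgn⟩ := hside x (Ioo_subset_Icc_self hxI)
  have h2 := Real.sq_sqrt (mul_nonneg two_pos.le (W.potential_nonneg hxI'))
  have hψ : μ * (s * ∫ s in z..u x, D s) ≤ Real.sqrt (2 * potential f D α (u x)) := by
    refine Real.le_sqrt_of_sq_le ?_
    rw [mul_pow, mul_pow, hs, one_mul]
    exact hρ _ hlt
  have hY : 0 ≤ s * ∫ s in z..u x, D s := by
    have h3 := W.integral_D_sign hz hxI'
    have h4 : (u x - z) * ∫ s in z..u x, D s =
        (s * (u x - z)) * (s * ∫ s in z..u x, D s) := by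
      rw [show (s * (u x - z)) * (s * ∫ s in z..u x, D s) =
        s ^ 2 * ((u x - z) * ∫ s in z..u x, D s) by ring, hs, one_mul]
    rw [h4] at h3
    exact nonneg_of_mul_nonneg_right h3 hsgn
  have hk := logistic_nonneg (ε := ε) (τ := τ) (y := y) (x := x) hM hμ
  simp only [Function.comp_apply]
  set X := dx a b u x
  set ψ := Real.sqrt (2 * potential f D α (u x))
  set k := logistic μ M ε τ y x
  set Φ := ∫ s in z..u x, D s
  have h3 : potential f D α (u x) = ψ ^ 2 / 2 := by linarith
  rw [h3]
  -- The density plus `F'` is this square plus the term of `h5`, which is nonnegative because `√(2G)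
  -- ≥ μ |Φ|` near the well.
  have h4 : 0 ≤ (ε * (D (u x) * X) + τ * s * (ψ - k * M * (s * Φ))) ^ 2 / (2 * ε) := by positivity
  have h5 : 0 ≤ k * M * (s * Φ) * (2 * (ψ - μ * (s * Φ))) / (2 * ε) := by
    have : 0 ≤ ψ - μ * (s * Φ) := by linarith
    positivity
  have hs' : s * s = 1 := by linarith
  have h6 : ε / 2 * (D (u x) * X) ^ 2 + ψ ^ 2 / 2 / ε +
      τ * (s * (ψ * D (u x) * X) - (τ * k * (2 * μ - M * k) / ε * (M * Φ ^ 2 / 2) +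
        k * (M * Φ * D (u x) * X))) =
      (ε * (D (u x) * X) + τ * s * (ψ - k * M * (s * Φ))) ^ 2 / (2 * ε) +
        k * M * (s * Φ) * (2 * (ψ - μ * (s * Φ))) / (2 * ε) := by
    have e1 : (ε * (D (u x) * X) + τ * s * (ψ - k * M * (s * Φ))) ^ 2 =
        ε ^ 2 * (D (u x) * X) ^ 2 + 2 * ε * (D (u x) * X) * τ * (s * ψ - k * M * (s ^ 2 * Φ)) +
        τ ^ 2 * s ^ 2 * (ψ ^ 2 - 2 * ψ * k * M * s * Φ + k ^ 2 * M ^ 2 * (s ^ 2 * Φ ^ 2)) := by ring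
    have e2 : k * M * (s * Φ) * (2 * (ψ - μ * (s * Φ))) =
        2 * k * M * s * Φ * ψ - 2 * k * M * μ * (s ^ 2 * Φ ^ 2) := by ring
    have e3 : τ * (s * (ψ * D (u x) * X) - (τ * k * (2 * μ - M * k) / ε * (M * Φ ^ 2 / 2) +
        k * (M * Φ * D (u x) * X))) = τ * (s * (ψ * D (u x) * X)) -
        τ ^ 2 * k * (2 * μ - M * k) / ε * (M * Φ ^ 2 / 2) - τ * (k * (M * Φ * D (u x) * X)) := by
      ring
    rw [e1, e2, e3, hτ, hs]
    field_simp
    ring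
  linarith

end IsDoubleWell

/-! ### Exponentially sharp lower bound for the energy. -/

theorem integral_Ioo_add {g : ℝ → ℝ} {p q x : ℝ} (hg : IntegrableOn g (Ioo p q))
    (hp : p ≤ x) (hq : x ≤ q) :
    ∫ y in Ioo p q, g y = (∫ y in Ioo p x, g y) + ∫ y in Ioo x q, g y := by
  have h : IntervalIntegrable g volume p q :=
    (intervalIntegrable_iff_integrableOn_Ioo_of_le (hp.trans hq)).2 hg
  have hx : x ∈ uIcc p q := by rw [uIcc_of_le (hp.trans hq)]; exact ⟨hp, hq⟩
  have := intervalIntegral.integral_add_adjacent_intervals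
    (h.mono_set (uIcc_subset_uIcc left_mem_uIcc hx))
    (h.mono_set (uIcc_subset_uIcc hx right_mem_uIcc))
  simpa only [intervalIntegral.integral_of_le, hp, hq, hp.trans hq, integral_Ioc_eq_integral_Ioo]
    using this.symm

/-- A function that is `L¹`-close to `v` is close to `v` at some point of each subinterval. -/
theorem exists_abs_sub_le {a b p q ρ : ℝ} {u v : ℝ → ℝ} (hpq : p < q) (hap : a ≤ p) (hqb : q ≤ b)
    (hρ : 0 < ρ)
    (h : normLp 1 a b (fun x => u x - v x) ≤ ENNReal.ofReal (ρ * (q - p) / 2)) :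
    ∃ x ∈ Ioo p q, |u x - v x| ≤ ρ := by
  by_contra! hcon
  rw [normLp, eLpNorm_one_eq_lintegral_enorm] at h
  have h1 : ENNReal.ofReal (ρ * (q - p)) ≤ ∫⁻ x in Ioo a b, ‖u x - v x‖ₑ := by
    calc ENNReal.ofReal (ρ * (q - p)) = ∫⁻ _ in Ioo p q, ENNReal.ofReal ρ := by
          rw [setLIntegral_const, Real.volume_Ioo, ENNReal.ofReal_mul hρ.le]
      _ ≤ ∫⁻ x in Ioo p q, ‖u x - v x‖ₑ := by
          refine setLIntegral_mono' measurableSet_Ioo fun x hx => ?_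
          rw [Real.enorm_eq_ofReal_abs]
          exact ENNReal.ofReal_le_ofReal (hcon x hx).le
      _ ≤ _ := lintegral_mono_set (Ioo_subset_Ioo hap hqb)
  have h2 := h1.trans h
  have h3 : 0 < ρ * (q - p) := mul_pos hρ (sub_pos.2 hpq)
  rw [ENNReal.ofReal_le_ofReal_iff (by linarith)] at h2
  linarith

theorem energy_eq (f D : ℝ → ℝ) (α : ℝ) {a b : ℝ} (hab : a ≤ b) (ε : ℝ) (u : ℝ → ℝ) :
    energy f D α a b ε u = ∫ x in Ioo a b, density f D α a b ε u x := by
  rw [energy, intervalIntegral.integral_of_le hab, integral_Ioc_eq_integral_Ioo]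
  rfl

namespace IsDoubleWell

variable {I : Set ℝ} {f D : ℝ → ℝ} {α β : ℝ} (W : IsDoubleWell I f D α β)
include W

theorem abs_geod_sub_le_integral_of_mem {a b ε p q x y : ℝ} (hε : 0 < ε) {u : ℝ → ℝ}
    (hu : IsH1 a b u) (hI : MapsTo u (Icc a b) I) (hap : a ≤ p) (hqb : q ≤ b)
    (hx : x ∈ Icc p q) (hy : y ∈ Icc p q) :
    |geod f D α (u x) - geod f D α (u y)| ≤ ∫ x in Ioo p q, density f D α a b ε u x := by
  wlog h : y ≤ x generalizing x y
  · rw [abs_sub_comm]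
    exact this hy hx (le_of_not_ge h)
  have hab : a ≤ b := hap.trans (hx.1.trans (hx.2.trans hqb))
  refine (W.abs_geod_sub_le_integral hε hu hI h (hap.trans hy.1) (hx.2.trans hqb)).trans ?_
  refine setIntegral_mono_set ((W.integrable_density hab ε hu hI).mono_set
    (Ioo_subset_Ioo hap hqb)) ?_ (Ioo_subset_Ioo hy.1 hx.2).eventuallyLE
  rw [EventuallyLE, ae_restrict_iff' measurableSet_Ioo]
  exact ae_of_all _ fun t ht => W.density_nonneg hε hI ⟨hap.trans ht.1.le, ht.2.le.trans hqb⟩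

/-- Up to an exponentially small error, a function that starts close to a well pays at least the
geodesic distance to that well. -/
theorem exists_well_bound {z μ : ℝ} (hz : z = α ∨ z = β) (hμ : 0 < μ)
    (hμz : 2 * μ ^ 2 = deriv f z / D z) :
    ∃ ρ > 0, ∃ C ≥ 0, ∀ ε > 0, ∀ a b, ∀ u : ℝ → ℝ, IsH1 a b u → MapsTo u (Icc a b) I →
      ∀ p q x₀, a ≤ p → p ≤ q → q ≤ b → (x₀ = p ∨ x₀ = q) → |u x₀ - z| ≤ ρ →
      |geod f D α (u x₀) - geod f D α z| - C * Real.exp (-(2 * μ * (q - p) / ε)) ≤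
        ∫ x in Ioo p q, density f D α a b ε u x := by
  have hzI := W.mem_of_well hz
  -- Near `z`, `2G` behaves like `2 μ² Φ²`. The value `3/2` gives `μ² < 2 μ² < M²` together with `M
  -- < 2 μ`, as the logistic function needs.
  set M := 3 / 2 * μ with hM
  have hM0 : 0 < M := by positivity
  have hMμ : M < 2 * μ := by linarith
  obtain ⟨ρ, hρ, hloc⟩ := W.exists_potential_bounds (c₁ := μ ^ 2) (c₂ := M ^ 2) hz
    (by rw [← hμz]; nlinarith) (by rw [← hμz, hM]; nlinarith)
  have hψ := fun w hw => W.abs_geod_sub_le hzI hM0 (fun u hu => ⟨(hloc u hu).1, (hloc u hu).2.2⟩)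
    (u := w) hw
  obtain ⟨m, hm, hfar⟩ := W.exists_abs_geod_sub_ge hz hρ
  have hc1 : Tendsto (fun w => |geod f D α w - geod f D α z|) (𝓝 z) (𝓝 0) := by
    have := ((W.hasDerivAt_geod hzI).continuousAt.sub_const (geod f D α z)).abs
    simpa [ContinuousAt] using this
  have hc2 : Tendsto (fun w => M * (∫ s in z..w, D s) ^ 2 / 2) (𝓝 z) (𝓝 0) := by
    have := (((W.hasDerivAt_integral_D hzI hzI).continuousAt.pow 2).const_mul M).div_const 2
    simpa [ContinuousAt] using this
  -- The start is close enough to `z` that its `Ψ`-distance is below `m / 2`, half the cost of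
  -- leaving the `ρ`-neighbourhood, and that the logistic coefficient is below `1`.
  obtain ⟨ρ', hρ', hnear⟩ := Metric.eventually_nhds_iff.1
    ((hc1.eventually (gt_mem_nhds (half_pos hm))).and (hc2.eventually (gt_mem_nhds one_pos)))
  simp only [Real.dist_eq] at hnear
  refine ⟨ρ' / 2, half_pos hρ', 2 * μ / (2 * μ - M), div_nonneg (by linarith) (by linarith), ?_⟩
  intro ε hε a b u hu hI p q x₀ hap hpq hqb hx₀ hux₀
  have hC : 0 ≤ 2 * μ / (2 * μ - M) * Real.exp (-(2 * μ * (q - p) / ε)) :=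
    mul_nonneg (div_nonneg (by linarith) (by linarith)) (Real.exp_pos _).le
  obtain ⟨hn1, hn2⟩ := hnear (show |u x₀ - z| < ρ' by linarith)
  have hx₀m : x₀ ∈ Icc p q := by
    rcases hx₀ with rfl | rfl
    exacts [left_mem_Icc.2 hpq, right_mem_Icc.2 hpq]
  have hsub : Icc p q ⊆ Icc a b := Icc_subset_Icc hap hqb
  by_cases hhit : ∃ x ∈ Icc p q, u x = z
  · obtain ⟨x, hx, hxz⟩ := hhit
    have := W.abs_geod_sub_le_integral_of_mem hε hu hI hap hqb hx₀m hx
    rw [hxz] at this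
    linarith
  -- An excursion to distance `ρ` costs more than `m - m / 2`, which exceeds the required
  -- `Ψ`-distance.
  by_cases hexit : ∃ x ∈ Icc p q, ρ ≤ |u x - z|
  · obtain ⟨x, hx, hxρ⟩ := hexit
    have h1 := W.abs_geod_sub_le_integral_of_mem hε hu hI hap hqb hx₀m hx
    have h2 := hfar (u x) (hI (hsub hx)) hxρ
    have h3 : |geod f D α (u x) - geod f D α z| ≤ |geod f D α (u x₀) - geod f D α (u x)| +
        |geod f D α (u x₀) - geod f D α z| := by
      rw [abs_sub_comm (geod f D α (u x₀)) (geod f D α (u x))]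
      exact abs_sub_le _ _ _
    linarith
  push Not at hhit hexit
  obtain ⟨s, hs, hside⟩ : ∃ s : ℝ, s ^ 2 = 1 ∧ ∀ x ∈ Icc p q, 0 < s * (u x - z) := by
    have hcu : ContinuousOn u (Icc p q) :=
      (hu.continuousOn (hap.trans (hpq.trans hqb))).mono hsub
    rcases lt_or_gt_of_ne (hhit x₀ hx₀m) with h | h
    · refine ⟨-1, by norm_num, fun x hx => ?_⟩
      by_contra hcon
      obtain ⟨t, ht, e⟩ := isPreconnected_Icc.intermediate_value hx₀m hx hcu
        (show z ∈ Icc (u x₀) (u x) from ⟨h.le, by linarith⟩)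
      exact hhit t ht e
    · refine ⟨1, by norm_num, fun x hx => ?_⟩
      by_contra hcon
      obtain ⟨t, ht, e⟩ := isPreconnected_Icc.intermediate_value hx hx₀m hcu
        (show z ∈ Icc (u x) (u x₀) from ⟨by linarith, h.le⟩)
      exact hhit t ht e
  have habs : |s| = 1 := by
    rw [← abs_one]
    exact (sq_eq_sq_iff_abs_eq_abs s 1).1 (by rw [hs]; norm_num)
  have hmono : ∀ x ∈ Icc p q,
      s * (geod f D α (u x) - geod f D α z) = |geod f D α (u x) - geod f D α z| := by
    intro x hx
    have h0 : 0 ≤ s * (geod f D α (u x) - geod f D α z) := by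
      have h1 := hside x hx
      rcases mul_self_eq_one_iff.1 ((sq s).symm.trans hs) with rfl | rfl
      · have := W.geod_monotoneOn hzI (hI (hsub hx)) (by linarith)
        linarith
      · have := W.geod_monotoneOn (hI (hsub hx)) hzI (by linarith)
        linarith
    rw [← abs_of_nonneg h0, abs_mul, habs, one_mul]
  -- The sign `τ` is the direction from `x₀` to the other end `x₁`. At `x₁` the logistic function is
  -- `1`, and `|Ψ(u) - Ψ(z)| ≤ M Φ² / 2` makes the boundary term there harmless.
  have hcal : ∀ τ x₁ : ℝ, (τ = 1 ∧ x₀ = p ∧ x₁ = q) ∨ (τ = -1 ∧ x₀ = q ∧ x₁ = p) →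
      |geod f D α (u x₀) - geod f D α z| -
        2 * μ / (2 * μ - M) * Real.exp (-(2 * μ * (q - p) / ε)) ≤
        ∫ x in Ioo p q, density f D α a b ε u x := by
    intro τ x₁ hτ
    have hx₁m : x₁ ∈ Icc p q := by
      rcases hτ with ⟨-, -, rfl⟩ | ⟨-, -, rfl⟩
      exacts [right_mem_Icc.2 hpq, left_mem_Icc.2 hpq]
    have h1 := W.calibration_le (τ := τ) (y := x₁) hε hzI hM0 hMμ hs
      (by rcases hτ with ⟨rfl, -⟩ | ⟨rfl, -⟩ <;> norm_num) (fun w hw => (hloc w hw).2.1) hu hI hpq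
      hap hqb (fun x hx => ⟨hexit x hx, hside x hx⟩)
    have h2 : (s * (geod f D α (u x₀) - geod f D α z) -
          logistic μ M ε τ x₁ x₀ * (M * (∫ s in z..u x₀, D s) ^ 2 / 2)) -
        (s * (geod f D α (u x₁) - geod f D α z) -
          logistic μ M ε τ x₁ x₁ * (M * (∫ s in z..u x₁, D s) ^ 2 / 2)) ≤
        ∫ x in Ioo p q, density f D α a b ε u x := by
      rcases hτ with ⟨rfl, rfl, rfl⟩ | ⟨rfl, rfl, rfl⟩ <;> linarith
    have h3 : τ * (x₁ - x₀) = q - p := by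
      rcases hτ with ⟨rfl, rfl, rfl⟩ | ⟨rfl, rfl, rfl⟩ <;> ring
    have h4 := logistic_le (ε := ε) (τ := τ) (y := x₁) (x := x₀) hM0 hMμ
    rw [h3] at h4
    rw [hmono x₀ hx₀m, hmono x₁ hx₁m, logistic_self hμ, one_mul] at h2
    have h5 := hψ (u x₁) (hexit x₁ hx₁m)
    have h6 : logistic μ M ε τ x₁ x₀ * (M * (∫ s in z..u x₀, D s) ^ 2 / 2) ≤
        2 * μ / (2 * μ - M) * Real.exp (-(2 * μ * (q - p) / ε)) * 1 :=
      mul_le_mul h4 hn2.le (by positivity) hC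
    linarith
  rcases hx₀ with h | h
  · exact hcal 1 q (Or.inl ⟨rfl, h, rfl⟩)
  · exact hcal (-1) p (Or.inr ⟨rfl, h, rfl⟩)

theorem lam_pos : 0 < lam f D α β :=
  lt_min (div_pos W.deriv_left (W.D_pos _ W.left_mem)) (div_pos W.deriv_right (W.D_pos _ W.right_mem))

/-- For each well `μ` is chosen so that the decay rate `2 μ` equals `√(2 f'(z)/D(z))`, which is at
least `√(2λ)`; the constants of the two wells are then merged. -/
theorem exists_wells_bound :
    ∃ ρ > 0, ∃ C ≥ 0, ∀ z, (z = α ∨ z = β) → ∀ ε > 0, ∀ a b, ∀ u : ℝ → ℝ, IsH1 a b u →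
      MapsTo u (Icc a b) I →
      ∀ p q x₀, a ≤ p → p ≤ q → q ≤ b → (x₀ = p ∨ x₀ = q) → |u x₀ - z| ≤ ρ →
      |geod f D α (u x₀) - geod f D α z| -
        C * Real.exp (-(Real.sqrt (2 * lam f D α β) * (q - p) / ε)) ≤
        ∫ x in Ioo p q, density f D α a b ε u x := by
  have hex : ∀ z, (z = α ∨ z = β) → ∃ ρ > 0, ∃ C ≥ 0, ∀ ε > 0, ∀ a b, ∀ u : ℝ → ℝ, IsH1 a b u →
      MapsTo u (Icc a b) I →
      ∀ p q x₀, a ≤ p → p ≤ q → q ≤ b → (x₀ = p ∨ x₀ = q) → |u x₀ - z| ≤ ρ →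
      |geod f D α (u x₀) - geod f D α z| -
        C * Real.exp (-(Real.sqrt (2 * lam f D α β) * (q - p) / ε)) ≤
        ∫ x in Ioo p q, density f D α a b ε u x := by
    intro z hz
    have hpos : 0 < deriv f z / D z := div_pos (W.deriv_well hz) (W.D_pos _ (W.mem_of_well hz))
    have hlam : lam f D α β ≤ deriv f z / D z := by
      rcases hz with rfl | rfl
      exacts [min_le_left _ _, min_le_right _ _]
    obtain ⟨ρ, hρ, C, hC, h⟩ := W.exists_well_bound (μ := Real.sqrt (deriv f z / D z / 2)) hz
      (Real.sqrt_pos.2 (by positivity)) (by rw [Real.sq_sqrt (by positivity)]; ring)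
    refine ⟨ρ, hρ, C, hC, fun ε hε a b u hu hI p q x₀ hap hpq hqb hx₀ hux₀ =>
      le_trans ?_ (h ε hε a b u hu hI p q x₀ hap hpq hqb hx₀ hux₀)⟩
    have hκ : Real.sqrt (2 * lam f D α β) ≤ 2 * Real.sqrt (deriv f z / D z / 2) := by
      refine Real.sqrt_le_iff.2 ⟨by positivity, ?_⟩
      rw [mul_pow, Real.sq_sqrt (by positivity)]
      linarith
    have hqp : 0 ≤ q - p := by linarith
    gcongr
  obtain ⟨ρ₁, hρ₁, C₁, hC₁, h₁⟩ := hex α (Or.inl rfl)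
  obtain ⟨ρ₂, hρ₂, C₂, hC₂, h₂⟩ := hex β (Or.inr rfl)
  refine ⟨min ρ₁ ρ₂, lt_min hρ₁ hρ₂, max C₁ C₂, le_max_of_le_left hC₁, ?_⟩
  rintro z (rfl | rfl) ε hε a b u hu hI p q x₀ hap hpq hqb hx₀ hux₀
  · refine le_trans ?_ (h₁ ε hε a b u hu hI p q x₀ hap hpq hqb hx₀ (hux₀.trans (min_le_left _ _)))
    gcongr
    exact le_max_left _ _
  · refine le_trans ?_ (h₂ ε hε a b u hu hI p q x₀ hap hpq hqb hx₀ (hux₀.trans (min_le_right _ _)))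
    gcongr
    exact le_max_right _ _

theorem abs_geod_sub_eq_gammaZero {y z : ℝ} (hy : y = α ∨ y = β) (hz : z = α ∨ z = β)
    (hne : y ≠ z) : |geod f D α y - geod f D α z| = gammaZero f D α β := by
  have h0 : geod f D α α = 0 := by simp [geod]
  have h1 : geod f D α β = gammaZero f D α β := rfl
  have h2 : 0 ≤ gammaZero f D α β := by
    rw [← h0, ← h1]
    exact W.geod_monotoneOn W.left_mem W.right_mem W.lt.le
  rcases hy with rfl | rfl <;> rcases hz with rfl | rfl
  · exact absurd rfl hne
  · rw [h0, h1, zero_sub, abs_neg, abs_of_nonneg h2]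
  · rw [h0, h1, sub_zero, abs_of_nonneg h2]
  · exact absurd rfl hne

/-- The energy of a function that is `L¹`-close to a step function with `N` jumps is at least
`N γ₀`, up to an exponentially small error. -/
theorem exists_energy_lower_bound {a b : ℝ} (hab : a ≤ b) {N : ℕ} {h : Fin N → ℝ} {r : ℝ}
    {v : ℝ → ℝ} (hv : IsStep α β a b N h r v) {A : ℝ}
    (hA : A ∈ Ioo 0 (r * Real.sqrt (2 * lam f D α β))) :
    ∃ δ > 0, ∃ C ≥ 0, ∀ ε > 0, ∀ u : ℝ → ℝ, IsH1 a b u → MapsTo u (Icc a b) I →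
      normLp 1 a b (fun x => u x - v x) ≤ ENNReal.ofReal δ →
      N * gammaZero f D α β - C * Real.exp (-A / ε) ≤ energy f D α a b ε u := by
  obtain ⟨ρ, hρ, C, hC, hbd⟩ := W.exists_wells_bound
  have hκ : 0 < Real.sqrt (2 * lam f D α β) := Real.sqrt_pos.2 (mul_pos two_pos W.lam_pos)
  set κ := Real.sqrt (2 * lam f D α β)
  -- Chosen so that `κ (r - η) = A`: a point within `η` of the jump still has length at least `r -
  -- η` to the end of its interval, which makes the error at most `C e^{-A/ε}`.
  set η := r - A / κ with hη
  have hη0 : 0 < η := by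
    have : A / κ < r := by rw [div_lt_iff₀ hκ]; exact hA.2
    linarith
  have hηr : η < r := by
    have : 0 < A / κ := div_pos hA.1 hκ
    linarith
  have hκη : κ * (r - η) = A := by
    rw [hη]
    field_simp
    ring
  refine ⟨ρ * η / 2, by positivity, N * (2 * C), by positivity, fun ε hε u hu hI hclose => ?_⟩
  have hint := W.integrable_density hab ε hu hI
  have hexp : ∀ l, r - η ≤ l → C * Real.exp (-(κ * l / ε)) ≤ C * Real.exp (-A / ε) := by
    intro l hl
    rw [← hκη, neg_div]
    gcongr
  have hone : ∀ i, gammaZero f D α β - 2 * C * Real.exp (-A / ε) ≤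
      ∫ x in Ioo (h i - r) (h i + r), density f D α a b ε u x := by
    intro i
    have hl := hv.left_le i
    have hr := hv.le_right i
    obtain ⟨y, hy, hyρ⟩ := exists_abs_sub_le (u := u) (v := v) (a := a) (b := b) (p := h i - η) (q := h i) (by linarith)
      (by linarith) (by linarith) hρ (show normLp 1 a b _ ≤ _ by rwa [sub_sub_cancel])
    obtain ⟨w, hw, hwρ⟩ := exists_abs_sub_le (u := u) (v := v) (a := a) (b := b) (p := h i) (q := h i + η) (by linarith)
      (by linarith) (by linarith) hρ (show normLp 1 a b _ ≤ _ by rwa [add_sub_cancel_left])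
    have hyI : y ∈ Icc a b := ⟨by linarith [hy.1], by linarith [hy.2]⟩
    have hwI : w ∈ Icc a b := ⟨by linarith [hw.1], by linarith [hw.2]⟩
    have hne : v y ≠ v w := by
      refine hv.jump i y hyI w hwI hy.2 hw.1 fun j hj hmem => ?_
      rcases lt_or_gt_of_ne hj with hlt | hlt
      · linarith [hv.separated j i hlt, hy.1, hmem.1]
      · linarith [hv.separated i j hlt, hw.2, hmem.2]
    have hyr : h i - r ≤ y := by linarith [hy.1]
    have hyw : y ≤ w := by linarith [hy.2, hw.1]
    have hwr : w ≤ h i + r := by linarith [hw.2]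
    have h1 := hbd (v y) (hv.values y hyI) ε hε a b u hu hI (h i - r) y y hl hyr hyI.2
      (Or.inr rfl) hyρ
    have h2 := hbd (v w) (hv.values w hwI) ε hε a b u hu hI w (h i + r) w hwI.1 hwr hr
      (Or.inl rfl) hwρ
    have h3 := W.abs_geod_sub_le_integral hε hu hI hyw hyI.1 hwI.2
    have e1 := hexp (y - (h i - r)) (by linarith [hy.1])
    have e2 := hexp (h i + r - w) (by linarith [hw.2])
    rw [integral_Ioo_add (hint.mono_set (Ioo_subset_Ioo hl hr)) hyr (hyw.trans hwr),
      integral_Ioo_add (hint.mono_set (Ioo_subset_Ioo hyI.1 hr)) hyw hwr,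
      ← W.abs_geod_sub_eq_gammaZero (hv.values w hwI) (hv.values y hyI) hne.symm]
    -- The three pieces of the interval pay for the three terms of the triangle inequality.
    have h4 : |geod f D α (v w) - geod f D α (v y)| ≤ |geod f D α (u w) - geod f D α (v w)| +
        |geod f D α (u w) - geod f D α (u y)| + |geod f D α (u y) - geod f D α (v y)| := by
      have t1 := abs_sub_le (geod f D α (v w)) (geod f D α (u w)) (geod f D α (v y))
      have t2 := abs_sub_le (geod f D α (u w)) (geod f D α (u y)) (geod f D α (v y))
      rw [abs_sub_comm (geod f D α (v w)) (geod f D α (u w))] at t1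
      linarith
    linarith
  have hdisj : Pairwise (Function.onFun Disjoint fun i => Ioo (h i - r) (h i + r)) := by
    intro i j hij
    rw [Function.onFun, Set.disjoint_left]
    intro x hx hx'
    rcases lt_or_gt_of_ne hij with hlt | hlt
    · linarith [hv.separated i j hlt, hx.2, hx'.1]
    · linarith [hv.separated j i hlt, hx.1, hx'.2]
  have hsubU : (⋃ i, Ioo (h i - r) (h i + r)) ⊆ Ioo a b :=
    iUnion_subset fun i => Ioo_subset_Ioo (hv.left_le i) (hv.le_right i)
  rw [energy_eq f D α hab]
  calc N * gammaZero f D α β - N * (2 * C) * Real.exp (-A / ε)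
      = ∑ i : Fin N, (gammaZero f D α β - 2 * C * Real.exp (-A / ε)) := by
        simp
        ring
    _ ≤ ∑ i : Fin N, ∫ x in Ioo (h i - r) (h i + r), density f D α a b ε u x :=
        Finset.sum_le_sum fun i _ => hone i
    _ = ∫ x in ⋃ i, Ioo (h i - r) (h i + r), density f D α a b ε u x := by
        rw [integral_iUnion_fintype (fun i => measurableSet_Ioo) hdisj]
        exact fun i => hint.mono_set ((subset_iUnion _ i).trans hsubU)
    _ ≤ ∫ x in Ioo a b, density f D α a b ε u x := by
        refine setIntegral_mono_set hint ?_ hsubU.eventuallyLE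
        rw [EventuallyLE, ae_restrict_iff' measurableSet_Ioo]
        exact ae_of_all _ fun t ht => W.density_nonneg hε hI (Ioo_subset_Icc_self ht)

end IsDoubleWell

/-! ### Calculus in L². -/

/-- The `L²(a, b)` norm as a real number. -/
noncomputable def norm₂ (a b : ℝ) (g : ℝ → ℝ) : ℝ := (normLp 2 a b g).toReal

/-- `g ∈ L²(a, b)`. -/
abbrev IsL2 (a b : ℝ) (g : ℝ → ℝ) : Prop := MemLp g 2 (volume.restrict (Ioo a b))

variable {a b : ℝ}

theorem norm₂_nonneg (g : ℝ → ℝ) : 0 ≤ norm₂ a b g := ENNReal.toReal_nonneg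

theorem norm₂_eq_norm_toLp {g : ℝ → ℝ} (hg : IsL2 a b g) : norm₂ a b g = ‖hg.toLp g‖ := by
  rw [Lp.norm_toLp]
  rfl

theorem norm₂_add_le {g h : ℝ → ℝ} (hg : IsL2 a b g) (hh : IsL2 a b h) :
    norm₂ a b (fun x => g x + h x) ≤ norm₂ a b g + norm₂ a b h := by
  have := norm_add_le (hg.toLp g) (hh.toLp h)
  rwa [← MemLp.toLp_add, ← norm₂_eq_norm_toLp, ← norm₂_eq_norm_toLp, ← norm₂_eq_norm_toLp] at this

/-- Only `h` must be in L²: `toReal` sends an infinite norm to `0`, so monotonicity could fail only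
through `h`. -/
theorem norm₂_mono {g h : ℝ → ℝ} (hh : IsL2 a b h) (hgh : ∀ x ∈ Ioo a b, |g x| ≤ |h x|) :
    norm₂ a b g ≤ norm₂ a b h := by
  refine ENNReal.toReal_mono hh.eLpNorm_ne_top (eLpNorm_mono_ae ?_)
  filter_upwards [ae_restrict_mem measurableSet_Ioo] with x hx
  exact hgh x hx

theorem norm₂_congr {g h : ℝ → ℝ} (hgh : ∀ x ∈ Ioo a b, g x = h x) :
    norm₂ a b g = norm₂ a b h := by
  refine congrArg ENNReal.toReal (eLpNorm_congr_ae ?_)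
  filter_upwards [ae_restrict_mem measurableSet_Ioo] with x hx
  exact hgh x hx

theorem norm₂_const_mul (c : ℝ) (g : ℝ → ℝ) :
    norm₂ a b (fun x => c * g x) = |c| * norm₂ a b g := by
  have : normLp 2 a b (fun x => c * g x) = ‖c‖ₑ * normLp 2 a b g := eLpNorm_const_smul c g 2 _
  rw [norm₂, this, ENNReal.toReal_mul]
  simp [norm₂]

theorem norm₂_sub_comm (g h : ℝ → ℝ) :
    norm₂ a b (fun x => g x - h x) = norm₂ a b (fun x => h x - g x) :=
  congrArg ENNReal.toReal (eLpNorm_sub_comm g h 2 _)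

theorem norm₂_abs (g : ℝ → ℝ) : norm₂ a b (fun x => |g x|) = norm₂ a b g :=
  congrArg ENNReal.toReal (eLpNorm_norm g)

theorem norm₂_self_sub (g : ℝ → ℝ) : norm₂ a b (fun x => g x - g x) = 0 := by
  simp [norm₂, normLp]

theorem integrable_mul {g h : ℝ → ℝ} (hg : IsL2 a b g) (hh : IsL2 a b h) :
    IntegrableOn (fun x => g x * h x) (Ioo a b) := MemLp.integrable_mul hg hh

theorem abs_integral_mul_le {g h : ℝ → ℝ} (hg : IsL2 a b g) (hh : IsL2 a b h) :
    |∫ x in Ioo a b, g x * h x| ≤ norm₂ a b g * norm₂ a b h := by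
  have h1 := abs_real_inner_le_norm (hg.toLp g) (hh.toLp h)
  rw [← norm₂_eq_norm_toLp, ← norm₂_eq_norm_toLp, L2.inner_def] at h1
  convert h1 using 2
  refine integral_congr_ae ?_
  filter_upwards [hg.coeFn_toLp, hh.coeFn_toLp] with x h2 h3
  rw [h2, h3]
  simp [mul_comm]

theorem norm₂_sq {g : ℝ → ℝ} (hg : IsL2 a b g) : norm₂ a b g ^ 2 = ∫ x in Ioo a b, g x ^ 2 := by
  rw [norm₂_eq_norm_toLp hg, ← real_inner_self_eq_norm_sq, L2.inner_def]
  refine integral_congr_ae ?_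
  filter_upwards [hg.coeFn_toLp] with x h2
  rw [h2]
  simp [sq]

theorem isL2_const (c : ℝ) : IsL2 a b (fun _ => c) := memLp_const c

theorem norm₂_one (hab : a ≤ b) : norm₂ a b (fun _ => 1) = Real.sqrt (b - a) := by
  rw [eq_comm, Real.sqrt_eq_iff_mul_self_eq (by linarith) (norm₂_nonneg _), ← sq,
    norm₂_sq (isL2_const 1)]
  simp [hab]

theorem integral_abs_le (hab : a ≤ b) {g : ℝ → ℝ} (hg : IsL2 a b g) :
    ∫ x in Ioo a b, |g x| ≤ Real.sqrt (b - a) * norm₂ a b g := by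
  have h1 := abs_integral_mul_le (isL2_const 1) hg.abs
  simp only [one_mul] at h1
  rw [norm₂_one hab] at h1
  have h2 : norm₂ a b |g| = norm₂ a b g := norm₂_abs g
  rw [h2] at h1
  exact (le_abs_self _).trans h1

theorem tendsto_norm₂ {ι : Type*} {l : Filter ι} {F : ι → ℝ → ℝ}
    (h : Tendsto (fun i => normLp 2 a b (F i)) l (𝓝 0)) :
    Tendsto (fun i => norm₂ a b (F i)) l (𝓝 0) :=
  (ENNReal.tendsto_toReal ENNReal.zero_ne_top).comp h

theorem _root_.ContinuousOn.isL2 {g : ℝ → ℝ} (hg : ContinuousOn g (Icc a b)) : IsL2 a b g :=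
  hg.memLp_top_Ioo.mono_exponent le_top

/-- Products of uniformly convergent and `L²`-convergent families converge in `L²`. -/
theorem tendsto_norm₂_mul {ι : Type*} {l : Filter ι} {φ F : ι → ℝ → ℝ} {φ₀ F₀ : ℝ → ℝ} {K : ℝ}
    (hφ : TendstoUniformlyOn φ φ₀ l (Ioo a b)) (hK : ∀ x ∈ Ioo a b, |φ₀ x| ≤ K)
    (hF : Tendsto (fun i => norm₂ a b (fun x => F i x - F₀ x)) l (𝓝 0))
    (hFm : ∀ᶠ i in l, IsL2 a b (F i)) (hF₀ : IsL2 a b F₀) :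
    Tendsto (fun i => norm₂ a b (fun x => φ i x * F i x - φ₀ x * F₀ x)) l (𝓝 0) := by
  rw [Metric.tendsto_nhds]
  intro e he
  obtain ⟨η, hη, hη1, hηe⟩ : ∃ η > 0, η ≤ 1 ∧ η * norm₂ a b F₀ < e / 2 := by
    have h0 := norm₂_nonneg (a := a) (b := b) F₀
    refine ⟨min 1 (e / (2 * (norm₂ a b F₀ + 1))), lt_min one_pos (by positivity),
      min_le_left _ _, ?_⟩
    calc _ ≤ e / (2 * (norm₂ a b F₀ + 1)) * norm₂ a b F₀ := by
          gcongr
          exact min_le_right _ _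
      _ < e / (2 * (norm₂ a b F₀ + 1)) * (norm₂ a b F₀ + 1) := by
          gcongr
          linarith
      _ = e / 2 := by field_simp
  have hlim : Tendsto (fun i => (|K| + 1) * norm₂ a b (fun x => F i x - F₀ x)) l (𝓝 0) := by
    simpa using hF.const_mul (|K| + 1)
  filter_upwards [Metric.tendstoUniformlyOn_iff.1 hφ η hη, hFm,
    hlim.eventually (gt_mem_nhds (half_pos he))] with i h1 h2 h3
  rw [Real.dist_eq, sub_zero, abs_of_nonneg (norm₂_nonneg _)]
  have m1 : IsL2 a b (fun x => F i x - F₀ x) := h2.sub hF₀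
  have m1' : IsL2 a b (fun x => (|K| + 1) * |F i x - F₀ x|) := m1.abs.const_mul _
  have m2' : IsL2 a b (fun x => η * |F₀ x|) := hF₀.abs.const_mul _
  calc norm₂ a b (fun x => φ i x * F i x - φ₀ x * F₀ x)
      ≤ norm₂ a b (fun x => (|K| + 1) * |F i x - F₀ x| + η * |F₀ x|) := by
        refine norm₂_mono (m1'.add m2') fun x hx => ?_
        refine le_trans ?_ (le_abs_self _)
        have e1 : |φ i x - φ₀ x| ≤ η := by
          have := h1 x hx
          rw [Real.dist_eq, abs_sub_comm] at this
          exact this.le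
        have e2 : |φ i x| ≤ |K| + 1 := by
          have := abs_sub_abs_le_abs_sub (φ i x) (φ₀ x)
          linarith [hK x hx, le_abs_self K]
        calc |φ i x * F i x - φ₀ x * F₀ x|
            = |φ i x * (F i x - F₀ x) + (φ i x - φ₀ x) * F₀ x| := by ring_nf
          _ ≤ |φ i x * (F i x - F₀ x)| + |(φ i x - φ₀ x) * F₀ x| := abs_add_le _ _
          _ ≤ _ := by
            rw [abs_mul, abs_mul]
            gcongr
    _ ≤ norm₂ a b (fun x => (|K| + 1) * |F i x - F₀ x|) + norm₂ a b (fun x => η * |F₀ x|) :=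
        norm₂_add_le m1' m2'
    _ = (|K| + 1) * norm₂ a b (fun x => F i x - F₀ x) + η * norm₂ a b F₀ := by
        rw [norm₂_const_mul, norm₂_const_mul, norm₂_abs, norm₂_abs, abs_of_pos hη,
          abs_of_pos (by positivity : 0 < |K| + 1)]
    _ < e := by linarith

theorem tendsto_integral_mul {ι : Type*} {l : Filter ι} {F H : ι → ℝ → ℝ} {F₀ H₀ : ℝ → ℝ}
    (hF : Tendsto (fun i => norm₂ a b (fun x => F i x - F₀ x)) l (𝓝 0))
    (hH : Tendsto (fun i => norm₂ a b (fun x => H i x - H₀ x)) l (𝓝 0))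
    (hFm : ∀ᶠ i in l, IsL2 a b (F i)) (hF₀ : IsL2 a b F₀)
    (hHm : ∀ᶠ i in l, IsL2 a b (H i)) (hH₀ : IsL2 a b H₀) :
    Tendsto (fun i => ∫ x in Ioo a b, F i x * H i x) l (𝓝 (∫ x in Ioo a b, F₀ x * H₀ x)) := by
  rw [tendsto_iff_norm_sub_tendsto_zero]
  have hlim : Tendsto (fun i => norm₂ a b (fun x => F i x - F₀ x) *
      (norm₂ a b (fun x => H i x - H₀ x) + norm₂ a b H₀) +
      norm₂ a b F₀ * norm₂ a b (fun x => H i x - H₀ x)) l (𝓝 0) := by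
    simpa using (hF.mul (hH.add_const (norm₂ a b H₀))).add (hH.const_mul (norm₂ a b F₀))
  refine squeeze_zero' (Eventually.of_forall fun i => norm_nonneg _) ?_ hlim
  filter_upwards [hFm, hHm] with i h1 h2
  have m1 : IsL2 a b (fun x => F i x - F₀ x) := h1.sub hF₀
  have m2 : IsL2 a b (fun x => H i x - H₀ x) := h2.sub hH₀
  have h3 : norm₂ a b (H i) ≤ norm₂ a b (fun x => H i x - H₀ x) + norm₂ a b H₀ := by
    simpa using norm₂_add_le m2 hH₀
  have h4 : (∫ x in Ioo a b, F i x * H i x) - ∫ x in Ioo a b, F₀ x * H₀ x =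
      (∫ x in Ioo a b, (F i x - F₀ x) * H i x) + ∫ x in Ioo a b, F₀ x * (H i x - H₀ x) := by
    rw [← integral_sub (integrable_mul h1 h2) (integrable_mul hF₀ hH₀),
      ← integral_add (integrable_mul m1 h2) (integrable_mul hF₀ m2)]
    congr 1
    ext x
    ring
  rw [h4, Real.norm_eq_abs]
  refine (abs_add_le _ _).trans (add_le_add ((abs_integral_mul_le m1 h2).trans ?_)
    (abs_integral_mul_le hF₀ m2))
  gcongr
  exact norm₂_nonneg _

/-! ### Uniform convergence from H¹ convergence. -/

/-- The one-dimensional Sobolev embedding `H¹ ⊂ C⁰`. -/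
theorem IsH1.abs_sub_le (hab : a < b) {u w : ℝ → ℝ} (hu : IsH1 a b u) (hw : IsH1 a b w) {x : ℝ}
    (hx : x ∈ Icc a b) :
    |u x - w x| ≤ norm₂ a b (fun y => u y - w y) / Real.sqrt (b - a) +
      Real.sqrt (b - a) * norm₂ a b (fun y => dx a b u y - dx a b w y) := by
  have hd : IsL2 a b (fun y => dx a b u y - dx a b w y) := hu.2.sub hw.2
  have hg : IsL2 a b (fun y => u y - w y) :=
    ((hu.continuousOn hab.le).sub (hw.continuousOn hab.le)).isL2
  have hac : AbsolutelyContinuousOnInterval (fun y => u y - w y) a b := hu.1.fun_sub hw.1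
  set J := ∫ y in Ioo a b, |dx a b u y - dx a b w y|
  -- The oscillation of `u - w` is at most the L¹ norm `J` of its derivative; averaging over `y`
  -- then brings in the norm of `u - w` itself.
  have hosc : ∀ y ∈ Icc a b, |u x - w x| ≤ |u y - w y| + J := by
    intro y hy
    have h1 := (hac.mono (c := y) (d := x) (by
      rw [uIcc_of_le hab.le]; exact uIcc_subset_Icc hy hx)).integral_deriv_eq_sub
    have hJ : |∫ t in y..x, deriv (fun y => u y - w y) t| ≤ J := by
      calc |∫ t in y..x, deriv (fun y => u y - w y) t|
          ≤ ∫ t in uIoc y x, |deriv (fun y => u y - w y) t| :=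
            by simpa only [Real.norm_eq_abs] using
              intervalIntegral.norm_integral_le_integral_norm_uIoc (μ := volume)
                (f := deriv fun y => u y - w y) (a := y) (b := x)
        _ ≤ ∫ t in Ioc a b, |deriv (fun y => u y - w y) t| := by
            refine setIntegral_mono_set ?_ (ae_of_all _ fun t => abs_nonneg _) ?_
            · exact ((intervalIntegrable_iff_integrableOn_Ioc_of_le hab.le).1
                hac.intervalIntegrable_deriv).abs
            · exact (Ioc_subset_Ioc (le_min hy.1 hx.1) (max_le hy.2 hx.2)).eventuallyLE
        _ = J := by
            rw [integral_Ioc_eq_integral_Ioo]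
            refine integral_congr_ae ?_
            filter_upwards [ae_hasDerivAt_of_absolutelyContinuous hab.le hu.1,
              ae_hasDerivAt_of_absolutelyContinuous hab.le hw.1] with t h2 h3
            rw [(h2.fun_sub h3).deriv]
    rw [h1] at hJ
    have := abs_sub_abs_le_abs_sub (u x - w x) (u y - w y)
    linarith
  have hint : (b - a) * |u x - w x| ≤ (∫ y in Ioo a b, |u y - w y|) + (b - a) * J := by
    have hi : IntegrableOn (fun y => |u y - w y|) (Ioo a b) :=
      (hg.integrable (by norm_num)).abs
    have h1 : ∫ _ in Ioo a b, |u x - w x| ≤ ∫ y in Ioo a b, (|u y - w y| + J) :=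
      setIntegral_mono_on (integrable_const _) (hi.add (integrable_const _)) measurableSet_Ioo
        fun y hy => hosc y (Ioo_subset_Icc_self hy)
    rw [integral_add hi (integrable_const _)] at h1
    simpa [hab.le] using h1
  have h2 := integral_abs_le hab.le hg
  have h3 : J ≤ _ := integral_abs_le hab.le hd
  have hs : 0 < Real.sqrt (b - a) := Real.sqrt_pos.2 (sub_pos.2 hab)
  have hs2 : Real.sqrt (b - a) * Real.sqrt (b - a) = b - a :=
    Real.mul_self_sqrt (sub_nonneg.2 hab.le)
  set σ := Real.sqrt (b - a)
  rw [← hs2] at hint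
  have h4 : σ * σ * |u x - w x| ≤ σ * norm₂ a b (fun y => u y - w y) + σ * σ * J := by linarith
  have h5 : |u x - w x| ≤ norm₂ a b (fun y => u y - w y) / σ + J := by
    rw [div_add' _ _ _ hs.ne', le_div_iff₀ hs]
    refine le_of_mul_le_mul_left ?_ hs
    linarith
  linarith

theorem tendstoUniformlyOn_of_H1 (hab : a < b) {ι : Type*} {l : Filter ι} {u : ι → ℝ → ℝ}
    {u₀ : ℝ → ℝ} (hu : ∀ᶠ i in l, IsH1 a b (u i)) (hu₀ : IsH1 a b u₀)
    (h0 : Tendsto (fun i => norm₂ a b (fun x => u i x - u₀ x)) l (𝓝 0))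
    (h1 : Tendsto (fun i => norm₂ a b (fun x => dx a b (u i) x - dx a b u₀ x)) l (𝓝 0)) :
    TendstoUniformlyOn u u₀ l (Icc a b) := by
  rw [Metric.tendstoUniformlyOn_iff]
  intro e he
  have hlim := (h0.div_const (Real.sqrt (b - a))).add (h1.const_mul (Real.sqrt (b - a)))
  simp only [zero_div, mul_zero, add_zero] at hlim
  filter_upwards [hu, hlim.eventually (gt_mem_nhds he)] with i hi hlt x hx
  rw [dist_comm, Real.dist_eq]
  exact (hi.abs_sub_le hab hu₀ hx).trans_lt hlt

/-- The compact range of `u₀` has room inside the open set `I`. The resulting compact window gives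
the uniform continuity that may fail on `I`. -/
theorem exists_eventually_mapsTo_Icc {I : Set ℝ} (hI : IsOpen I) (hc : I.OrdConnected)
    (hab : a ≤ b) {ι : Type*} {l : Filter ι} {u : ι → ℝ → ℝ} {u₀ : ℝ → ℝ}
    (hu : TendstoUniformlyOn u u₀ l (Icc a b)) (hcont : ContinuousOn u₀ (Icc a b))
    (hm : MapsTo u₀ (Icc a b) I) :
    ∃ m M, Icc m M ⊆ I ∧ MapsTo u₀ (Icc a b) (Icc m M) ∧
      ∀ᶠ i in l, MapsTo (u i) (Icc a b) (Icc m M) := by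
  obtain ⟨m, M, hmI, hMI, hmaps⟩ := exists_range_subset hab hcont hm
  obtain ⟨δ, hδ, hb⟩ := Metric.isOpen_iff.1 hI m hmI
  obtain ⟨δ', hδ', hb'⟩ := Metric.isOpen_iff.1 hI M hMI
  set κ := min δ δ' / 2
  have hκ : 0 < κ := half_pos (lt_min hδ hδ')
  have hm' : m - κ ∈ I := hb (by
    simp only [Metric.mem_ball, Real.dist_eq, sub_sub_cancel_left, abs_neg, abs_of_pos hκ]
    exact (half_lt_self (lt_min hδ hδ')).trans_le (min_le_left _ _))
  have hM' : M + κ ∈ I := hb' (by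
    simp only [Metric.mem_ball, Real.dist_eq, add_sub_cancel_left, abs_of_pos hκ]
    exact (half_lt_self (lt_min hδ hδ')).trans_le (min_le_right _ _))
  refine ⟨m - κ, M + κ, hc.out hm' hM', fun x hx => ?_, ?_⟩
  · have := hmaps hx
    exact ⟨by linarith [this.1], by linarith [this.2]⟩
  · filter_upwards [Metric.tendstoUniformlyOn_iff.1 hu κ hκ] with i hi x hx
    have h1 := hi x hx
    have h2 := hmaps hx
    rw [Real.dist_eq, abs_lt] at h1
    exact ⟨by linarith [h1.2, h2.1], by linarith [h1.1, h2.2]⟩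

theorem tendstoUniformlyOn_comp {I : Set ℝ} (hI : IsOpen I) (hc : I.OrdConnected)
    (hab : a ≤ b) {Θ : ℝ → ℝ} (hΘ : ContinuousOn Θ I) {ι : Type*} {l : Filter ι} {u : ι → ℝ → ℝ}
    {u₀ : ℝ → ℝ} (hu : TendstoUniformlyOn u u₀ l (Icc a b)) (hcont : ContinuousOn u₀ (Icc a b))
    (hm : MapsTo u₀ (Icc a b) I) :
    TendstoUniformlyOn (fun i x => Θ (u i x)) (fun x => Θ (u₀ x)) l (Icc a b) := by
  obtain ⟨m, M, hsub, h0, h1⟩ := exists_eventually_mapsTo_Icc hI hc hab hu hcont hm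
  have huc := isCompact_Icc.uniformContinuousOn_of_continuous (hΘ.mono hsub)
  rw [Metric.uniformContinuousOn_iff] at huc
  rw [Metric.tendstoUniformlyOn_iff] at hu ⊢
  intro e he
  obtain ⟨δ, hδ, h⟩ := huc e he
  filter_upwards [h1, hu δ hδ] with i hi hi' x hx
  exact h _ (h0 hx) _ (hi hx) (hi' x hx)

/-- Divided differences of a `C¹` function converge uniformly to the derivative. -/
theorem tendstoUniformlyOn_dslope {I : Set ℝ} (hI : IsOpen I) (hc : I.OrdConnected)
    (hab : a ≤ b) {Θ θ : ℝ → ℝ} (hd : ∀ y ∈ I, HasDerivAt Θ (θ y) y) (hθ : ContinuousOn θ I)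
    {ι : Type*} {l : Filter ι} {u : ι → ℝ → ℝ}
    {u₀ : ℝ → ℝ} (hu : TendstoUniformlyOn u u₀ l (Icc a b)) (hcont : ContinuousOn u₀ (Icc a b))
    (hm : MapsTo u₀ (Icc a b) I) :
    TendstoUniformlyOn (fun i x => dslope Θ (u₀ x) (u i x)) (fun x => θ (u₀ x)) l (Icc a b) := by
  obtain ⟨m, M, hsub, h0, h1⟩ := exists_eventually_mapsTo_Icc hI hc hab hu hcont hm
  have huc := isCompact_Icc.uniformContinuousOn_of_continuous (hθ.mono hsub)
  rw [Metric.uniformContinuousOn_iff] at huc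
  rw [Metric.tendstoUniformlyOn_iff] at hu ⊢
  intro e he
  obtain ⟨δ, hδ, h⟩ := huc e he
  filter_upwards [h1, hu δ hδ] with i hi hi' x hx
  have hx0 := h0 hx
  have hx1 := hi hx
  -- The mean value theorem; using `dslope` also covers the points where the two functions coincide.
  have key : ∃ ξ ∈ Icc m M, dist (u₀ x) ξ ≤ dist (u₀ x) (u i x) ∧
      dslope Θ (u₀ x) (u i x) = θ ξ := by
    rcases lt_trichotomy (u₀ x) (u i x) with hlt | heq | hlt
    · have hs : Icc (u₀ x) (u i x) ⊆ I := (Icc_subset_Icc hx0.1 hx1.2).trans hsub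
      obtain ⟨ξ, hξ, e⟩ := exists_hasDerivAt_eq_slope Θ θ hlt
        (fun y hy => (hd y (hs hy)).continuousAt.continuousWithinAt)
        (fun y hy => hd y (hs (Ioo_subset_Icc_self hy)))
      refine ⟨ξ, ⟨by linarith [hξ.1, hx0.1], by linarith [hξ.2, hx1.2]⟩, ?_, ?_⟩
      · rw [dist_comm, dist_comm (u₀ x), Real.dist_eq, Real.dist_eq,
          abs_of_pos (by linarith [hξ.1]), abs_of_pos (by linarith)]
        linarith [hξ.2]
      · rw [dslope_of_ne _ hlt.ne', slope_def_field, e]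
    · refine ⟨u₀ x, hx0, by simp, ?_⟩
      rw [← heq, dslope_same, (hd _ (hsub hx0)).deriv]
    · have hs : Icc (u i x) (u₀ x) ⊆ I := (Icc_subset_Icc hx1.1 hx0.2).trans hsub
      obtain ⟨ξ, hξ, e⟩ := exists_hasDerivAt_eq_slope Θ θ hlt
        (fun y hy => (hd y (hs hy)).continuousAt.continuousWithinAt)
        (fun y hy => hd y (hs (Ioo_subset_Icc_self hy)))
      refine ⟨ξ, ⟨by linarith [hξ.1, hx1.1], by linarith [hξ.2, hx0.2]⟩, ?_, ?_⟩
      · rw [Real.dist_eq, Real.dist_eq,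
          abs_of_pos (by linarith [hξ.2]), abs_of_pos (by linarith)]
        linarith [hξ.1]
      · rw [dslope_of_ne _ hlt.ne, slope_comm, slope_def_field, e]
  obtain ⟨ξ, hξ, hdist, e⟩ := key
  rw [e]
  exact h _ hx0 _ hξ (hdist.trans_lt (hi' x hx))

/-! ### Continuity and first variation of the energy. -/

namespace IsDoubleWell

variable {I : Set ℝ} {f D : ℝ → ℝ} {α β : ℝ} (W : IsDoubleWell I f D α β)
include W

/-- The products, including the factor `1`, present the energy as a sum of L² pairings, the form to
which `tendsto_integral_mul` applies. -/
theorem energy_eq_add (hab : a ≤ b) (ε : ℝ) {u : ℝ → ℝ} (hu : IsH1 a b u)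
    (hI : MapsTo u (Icc a b) I) :
    energy f D α a b ε u =
      ε / 2 * (∫ x in Ioo a b, (D (u x) * dx a b u x) * (D (u x) * dx a b u x)) +
      1 / ε * ∫ x in Ioo a b, potential f D α (u x) * 1 := by
  have h1 := W.memLp_flux hab hu hI
  have h2 : IsL2 a b (fun x => potential f D α (u x)) :=
    (W.contG.comp (hu.continuousOn hab) hI).isL2
  rw [energy_eq f D α hab, ← integral_const_mul, ← integral_const_mul,
    ← integral_add ((integrable_mul h1 h1).const_mul _)
      ((integrable_mul h2 (isL2_const 1)).const_mul _)]
  congr 1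
  ext x
  rw [density]
  ring

theorem tendsto_energy (hab : a < b) (ε : ℝ) {ι : Type*} {l : Filter ι} {u : ι → ℝ → ℝ}
    {u₀ : ℝ → ℝ} (hu : ∀ᶠ i in l, IsH1 a b (u i)) (hu₀ : IsH1 a b u₀)
    (hI : ∀ᶠ i in l, MapsTo (u i) (Icc a b) I) (hI₀ : MapsTo u₀ (Icc a b) I)
    (h0 : Tendsto (fun i => norm₂ a b (fun x => u i x - u₀ x)) l (𝓝 0))
    (h1 : Tendsto (fun i => norm₂ a b (fun x => dx a b (u i) x - dx a b u₀ x)) l (𝓝 0)) :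
    Tendsto (fun i => energy f D α a b ε (u i)) l (𝓝 (energy f D α a b ε u₀)) := by
  have hunif := tendstoUniformlyOn_of_H1 hab hu hu₀ h0 h1
  have hc := hu₀.continuousOn hab.le
  have hD := (tendstoUniformlyOn_comp W.isOpen W.ordConnected hab.le W.contD hunif hc hI₀).mono
    Ioo_subset_Icc_self
  have hG := (tendstoUniformlyOn_comp W.isOpen W.ordConnected hab.le W.contG hunif hc hI₀).mono
    Ioo_subset_Icc_self
  obtain ⟨K, hK⟩ := isCompact_Icc.exists_bound_of_continuousOn (W.contD.comp hc hI₀)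
  obtain ⟨K', hK'⟩ := isCompact_Icc.exists_bound_of_continuousOn (W.contG.comp hc hI₀)
  have e1 := tendsto_norm₂_mul hD (fun x hx => hK x (Ioo_subset_Icc_self hx)) h1
    (hu.mono fun i hi => hi.2) hu₀.2
  have e2 := tendsto_norm₂_mul (F := fun _ _ => 1) (F₀ := fun _ => 1) hG
    (fun x hx => hK' x (Ioo_subset_Icc_self hx))
    (by simpa [norm₂, normLp] using tendsto_const_nhds) (Eventually.of_forall fun _ => isL2_const 1)
    (isL2_const 1)
  simp only [mul_one] at e2
  have m1 : ∀ᶠ i in l, IsL2 a b (fun x => D (u i x) * dx a b (u i) x) :=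
    (hu.and hI).mono fun i hi => W.memLp_flux hab.le hi.1 hi.2
  have m2 : ∀ᶠ i in l, IsL2 a b (fun x => potential f D α (u i x)) :=
    (hu.and hI).mono fun i hi => (W.contG.comp (hi.1.continuousOn hab.le) hi.2).isL2
  have m1' := W.memLp_flux hab.le hu₀ hI₀
  have m2' : IsL2 a b (fun x => potential f D α (u₀ x)) := (W.contG.comp hc hI₀).isL2
  have l1 := tendsto_integral_mul e1 e1 m1 m1' m1 m1'
  have l2 := tendsto_integral_mul (H := fun _ _ => 1) (H₀ := fun _ => 1) e2
    (by simpa [norm₂, normLp] using tendsto_const_nhds) m2 m2'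
    (Eventually.of_forall fun _ => isL2_const 1) (isL2_const 1)
  rw [W.energy_eq_add hab.le ε hu₀ hI₀]
  refine ((l1.const_mul (ε / 2)).add (l2.const_mul (1 / ε))).congr' ?_
  filter_upwards [hu, hI] with i h2 h3
  rw [W.energy_eq_add hab.le ε h2 h3]

/-- The gradient part of the energy is convex in `Φ(u)`, which bounds the energy from below by its
first variation. -/
theorem first_variation_le {ε : ℝ} (hab : a ≤ b) (hε : 0 < ε) {u w : ℝ → ℝ} (hu : IsH1 a b u)
    (hw : IsH1 a b w) (hI : MapsTo u (Icc a b) I) (hIw : MapsTo w (Icc a b) I)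
    (hp : AbsolutelyContinuousOnInterval (fun x => D (u x) * dx a b u x) a b)
    (ha : dx a b u a = 0) (hb : dx a b u b = 0) :
    1 / ε * (∫ x in Ioo a b, (potential f D α (w x) - potential f D α (u x)) * 1) -
      ε * (∫ x in Ioo a b, ((∫ s in α..w x, D s) - ∫ s in α..u x, D s) *
        dx a b (fun x => D (u x) * dx a b u x) x) ≤
      energy f D α a b ε w - energy f D α a b ε u := by
  have hΦ : ∀ {w : ℝ → ℝ}, IsH1 a b w → MapsTo w (Icc a b) I →
      AbsolutelyContinuousOnInterval (fun x => ∫ s in α..w x, D s) a b := fun {w} hw hIw =>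
    comp_absolutelyContinuous (Θ := fun y => ∫ s in α..y, D s) W.ordConnected hab
      (fun y hy => W.hasDerivAt_integral_D W.left_mem hy) W.contD hw.1 hIw
  have hg := (hΦ hw hIw).fun_sub (hΦ hu hI)
  have pw := W.memLp_flux hab hw hIw
  have pu := W.memLp_flux hab hu hI
  have hdiff : IsL2 a b (fun x => D (w x) * dx a b w x - D (u x) * dx a b u x) := pw.sub pu
  have hG : ∀ {w : ℝ → ℝ}, IsH1 a b w → MapsTo w (Icc a b) I →
      IsL2 a b (fun x => potential f D α (w x)) := fun hw hIw =>
    (W.contG.comp (hw.continuousOn hab) hIw).isL2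
  -- Integration by parts against `Φ(w) - Φ(u)`; the boundary terms vanish by the Neumann conditions
  -- on `u`.
  have hibp : ∫ x in Ioo a b, (D (u x) * dx a b u x) *
      (D (w x) * dx a b w x - D (u x) * dx a b u x) =
      -∫ x in Ioo a b, ((∫ s in α..w x, D s) - ∫ s in α..u x, D s) *
        dx a b (fun x => D (u x) * dx a b u x) x := by
    have h := hp.integral_mul_deriv_eq_deriv_mul hg
    rw [ha, hb, intervalIntegral.integral_of_le hab, intervalIntegral.integral_of_le hab,
      integral_Ioc_eq_integral_Ioo, integral_Ioc_eq_integral_Ioo] at h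
    simp only [mul_zero, zero_mul, sub_zero, zero_sub] at h
    convert h using 1
    · refine integral_congr_ae ?_
      filter_upwards [ae_hasDerivAt_of_absolutelyContinuous hab hu.1,
        ae_hasDerivAt_of_absolutelyContinuous hab hw.1, ae_restrict_mem measurableSet_Ioo]
        with x h1 h2 hx
      have d1 := (W.hasDerivAt_integral_D W.left_mem (hI (Ioo_subset_Icc_self hx))).comp x h1
      have d2 := (W.hasDerivAt_integral_D W.left_mem (hIw (Ioo_subset_Icc_self hx))).comp x h2
      rw [show deriv (fun x => (∫ s in α..w x, D s) - ∫ s in α..u x, D s) x = _ from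
        (d2.sub d1).deriv]
    · congr 1
      refine setIntegral_congr_fun measurableSet_Ioo fun x hx => ?_
      simp only [dx_eq_deriv hx (fun x => D (u x) * dx a b u x)]
      ring
  have hsq : 0 ≤ ε / 2 * ∫ x in Ioo a b, (D (w x) * dx a b w x - D (u x) * dx a b u x) *
      (D (w x) * dx a b w x - D (u x) * dx a b u x) :=
    mul_nonneg (by positivity) (integral_nonneg fun x => mul_self_nonneg _)
  have hexp : ∫ x in Ioo a b, (D (w x) * dx a b w x - D (u x) * dx a b u x) *
      (D (w x) * dx a b w x - D (u x) * dx a b u x) =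
      (∫ x in Ioo a b, (D (w x) * dx a b w x) * (D (w x) * dx a b w x)) -
      (∫ x in Ioo a b, (D (u x) * dx a b u x) * (D (u x) * dx a b u x)) -
      2 * ∫ x in Ioo a b, (D (u x) * dx a b u x) *
        (D (w x) * dx a b w x - D (u x) * dx a b u x) := by
    have hi : IntegrableOn (fun x => (D (w x) * dx a b w x) * (D (w x) * dx a b w x) -
        (D (u x) * dx a b u x) * (D (u x) * dx a b u x)) (Ioo a b) :=
      (integrable_mul pw pw).sub (integrable_mul pu pu)
    rw [← integral_const_mul, ← integral_sub (integrable_mul pw pw) (integrable_mul pu pu),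
      ← integral_sub hi ((integrable_mul pu hdiff).const_mul 2)]
    congr 1
    ext x
    ring
  have hGs : ∫ x in Ioo a b, (potential f D α (w x) - potential f D α (u x)) * 1 =
      (∫ x in Ioo a b, potential f D α (w x) * 1) - ∫ x in Ioo a b, potential f D α (u x) * 1 := by
    rw [← integral_sub (integrable_mul (hG hw hIw) (isL2_const 1))
      (integrable_mul (hG hu hI) (isL2_const 1))]
    congr 1
    ext x
    ring
  rw [W.energy_eq_add hab ε hu hI, W.energy_eq_add hab ε hw hIw, hGs]
  rw [hexp, hibp] at hsq
  linarith

end IsDoubleWell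

/-! ### Energy dissipation along solutions. -/

/-- The right-hand side of the equation, i.e. the time derivative of the solution. -/
noncomputable def rhs (f D : ℝ → ℝ) (a b ε : ℝ) (u : ℝ → ℝ) (x : ℝ) : ℝ :=
  ε ^ 2 * dx a b (fun y => D (u y) * dx a b u y) x - f (u x)

namespace IsSolution

variable {I : Set ℝ} {f D : ℝ → ℝ} {ε : ℝ} {u₀ : ℝ → ℝ} {u : ℝ → ℝ → ℝ}

theorem tendstoUniformlyOn (S : IsSolution I f D a b ε u₀ u) (hab : a < b) {t : ℝ} (ht : 0 ≤ t) :
    TendstoUniformlyOn u (u t) (𝓝[Ici 0] t) (Icc a b) :=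
  tendstoUniformlyOn_of_H1 hab (eventually_mem_nhdsWithin.mono fun s hs => S.memH1 s hs)
    (S.memH1 t ht) (tendsto_norm₂ (S.continuous_L2 t ht)) (tendsto_norm₂ (S.continuous_H1 t ht))

theorem isL2 (S : IsSolution I f D a b ε u₀ u) (hab : a < b) {t : ℝ} (ht : 0 ≤ t) :
    IsL2 a b (u t) := ((S.memH1 t ht).continuousOn hab.le).isL2

theorem isL2_sub (S : IsSolution I f D a b ε u₀ u) (hab : a < b) {s t : ℝ} (hs : 0 ≤ s)
    (ht : 0 ≤ t) : IsL2 a b (fun x => u s x - u t x) := (S.isL2 hab hs).sub (S.isL2 hab ht)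

theorem norm₂_sub_le_add (S : IsSolution I f D a b ε u₀ u) (hab : a < b) {r s t : ℝ} (hr : 0 ≤ r)
    (hs : 0 ≤ s) (ht : 0 ≤ t) : norm₂ a b (fun x => u r x - u t x) ≤
      norm₂ a b (fun x => u r x - u s x) + norm₂ a b (fun x => u s x - u t x) := by
  simpa using norm₂_add_le (S.isL2_sub hab hr hs) (S.isL2_sub hab hs ht)

theorem continuousOn_norm₂_sub (S : IsSolution I f D a b ε u₀ u) (hab : a < b) {T : ℝ}
    (hT : 0 ≤ T) : ContinuousOn (fun t => norm₂ a b (fun x => u t x - u T x)) (Ici 0) := by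
  intro t ht
  rw [ContinuousWithinAt, tendsto_iff_norm_sub_tendsto_zero]
  refine squeeze_zero' (Eventually.of_forall fun i => norm_nonneg _) ?_
    (tendsto_norm₂ (S.continuous_L2 t ht))
  filter_upwards [eventually_mem_nhdsWithin] with s hs
  have h1 := S.norm₂_sub_le_add hab hs ht hT
  have h2 := S.norm₂_sub_le_add hab ht hs hT
  rw [norm₂_sub_comm (u t) (u s)] at h2
  rw [Real.norm_eq_abs]
  exact abs_le.2 ⟨by linarith, by linarith⟩

variable {α β : ℝ}

theorem continuousOn_energy (S : IsSolution I f D a b ε u₀ u) (W : IsDoubleWell I f D α β)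
    (hab : a < b) : ContinuousOn (fun t => energy f D α a b ε (u t)) (Ici 0) := fun t ht =>
  W.tendsto_energy hab ε (eventually_mem_nhdsWithin.mono fun s hs => S.memH1 s hs)
    (S.memH1 t ht) (eventually_mem_nhdsWithin.mono fun s hs => S.mem_I s hs) (S.mem_I t ht)
    (tendsto_norm₂ (S.continuous_L2 t ht)) (tendsto_norm₂ (S.continuous_H1 t ht))

theorem tendsto_add_left {t : ℝ} (ht : 0 < t) :
    Tendsto (fun s => t + s) (𝓝[<] 0) (𝓝[Ici 0] t) := by
  have hc : Tendsto (fun s => t + s) (𝓝 0) (𝓝 t) := by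
    simpa using (continuous_const_add t).tendsto 0
  refine tendsto_nhdsWithin_iff.2 ⟨hc.mono_left nhdsWithin_le_nhds, ?_⟩
  exact (hc.eventually (le_mem_nhds ht)).filter_mono nhdsWithin_le_nhds

theorem tendsto_quotient (S : IsSolution I f D a b ε u₀ u) {t : ℝ} (ht : 0 < t) :
    Tendsto (fun s => norm₂ a b (fun x => (u (t + s) x - u t x) / s - rhs f D a b ε (u t) x))
      (𝓝[<] 0) (𝓝 0) :=
  (tendsto_norm₂ (S.equation t ht)).mono_left (nhdsWithin_mono _ fun _ hx => ne_of_lt hx)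

theorem isL2_quotient (S : IsSolution I f D a b ε u₀ u) (hab : a < b) {t : ℝ} (ht : 0 < t) :
    ∀ᶠ s in 𝓝[<] (0 : ℝ), IsL2 a b (fun x => (u (t + s) x - u t x) / s) := by
  filter_upwards [(tendsto_add_left ht).eventually eventually_mem_nhdsWithin] with s hs
  simpa only [div_eq_inv_mul] using (S.isL2_sub hab hs ht.le).const_mul s⁻¹

/-- The difference quotients are in L² and converge, so one of them is at finite distance from the
right-hand side; measurability is separate. -/
theorem isL2_rhs (S : IsSolution I f D a b ε u₀ u) (hf : ContinuousOn f I) (hab : a < b) {t : ℝ}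
    (ht : 0 < t) : IsL2 a b (rhs f D a b ε (u t)) := by
  have hlim := (S.equation t ht).mono_left
    (nhdsWithin_mono 0 fun x (hx : x ∈ Iio (0 : ℝ)) => ne_of_lt hx)
  obtain ⟨s, hs, hs'⟩ :=
    ((S.isL2_quotient hab ht).and (hlim.eventually (gt_mem_nhds ENNReal.zero_lt_top))).exists
  have hm : AEStronglyMeasurable (rhs f D a b ε (u t)) (volume.restrict (Ioo a b)) := by
    refine ((aestronglyMeasurable_dx a b _).const_mul _).sub ?_
    exact (hf.comp ((S.memH1 t ht.le).continuousOn hab.le) (S.mem_I t ht.le)).isL2.1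
  have hd : IsL2 a b (fun x => (u (t + s) x - u t x) / s - rhs f D a b ε (u t) x) :=
    ⟨hs.1.sub hm, hs'⟩
  have e : rhs f D a b ε (u t) = (fun x => (u (t + s) x - u t x) / s) -
      fun x => (u (t + s) x - u t x) / s - rhs f D a b ε (u t) x := by
    ext x
    simp
  rw [e]
  exact hs.sub hd

/-- A chain rule in L²: the quotient of `Θ(u)` is a divided difference, which converges uniformly,
times the quotient of `u`, which converges in L². -/
theorem tendsto_quotient_comp (S : IsSolution I f D a b ε u₀ u) (hI : IsOpen I)
    (hc : I.OrdConnected) (hf : ContinuousOn f I) (hab : a < b) {t : ℝ} (ht : 0 < t) {Θ θ : ℝ → ℝ}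
    (hd : ∀ y ∈ I, HasDerivAt Θ (θ y) y) (hθ : ContinuousOn θ I) :
    Tendsto (fun s => norm₂ a b (fun x => (Θ (u (t + s) x) - Θ (u t x)) / s -
      θ (u t x) * rhs f D a b ε (u t) x)) (𝓝[<] 0) (𝓝 0) := by
  have hcont := (S.memH1 t ht.le).continuousOn hab.le
  have hu : TendstoUniformlyOn (fun s => u (t + s)) (u t) (𝓝[<] 0) (Icc a b) := fun V hV =>
    (tendsto_add_left ht).eventually (S.tendstoUniformlyOn hab ht.le V hV)
  obtain ⟨K, hK⟩ := isCompact_Icc.exists_bound_of_continuousOn (hθ.comp hcont (S.mem_I t ht.le))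
  refine (tendsto_norm₂_mul ((tendstoUniformlyOn_dslope hI hc hab.le hd hθ hu hcont
    (S.mem_I t ht.le)).mono Ioo_subset_Icc_self) (fun x hx => hK x (Ioo_subset_Icc_self hx))
    (S.tendsto_quotient ht) (S.isL2_quotient hab ht) (S.isL2_rhs hf hab ht)).congr fun s => ?_
  refine norm₂_congr fun x _ => ?_
  have := sub_smul_dslope Θ (u t x) (u (t + s) x)
  rw [smul_eq_mul] at this
  rw [← this]
  ring

/-- The energy dissipation inequality, for backward difference quotients. -/
theorem eventually_le_energy_quotient (S : IsSolution I f D a b ε u₀ u)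
    (W : IsDoubleWell I f D α β) (hD : ContDiffOn ℝ 2 D I) {d : ℝ} (hdD : ∀ u ∈ I, d ≤ D u)
    (hab : a < b) (hε : 0 < ε) {t : ℝ} (ht : 0 < t) {c : ℝ}
    (hc : c < d / ε * norm₂ a b (rhs f D a b ε (u t)) ^ 2) :
    ∀ᶠ s in 𝓝[<] (0 : ℝ),
      c ≤ (energy f D α a b ε (u (t + s)) - energy f D α a b ε (u t)) / (-s) := by
  have hu := S.memH1 t ht.le
  have hI : MapsTo (u t) (Icc a b) I := S.mem_I t ht.le
  have hcont := hu.continuousOn hab.le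
  have hF := S.isL2_rhs W.contf hab ht
  have hp : AbsolutelyContinuousOnInterval (fun x => D (u t x) * dx a b (u t) x) a b := by
    refine (comp_absolutelyContinuous (θ := deriv D) W.ordConnected hab.le (fun y hy => ?_)
      (hD.continuousOn_deriv_of_isOpen W.isOpen (by norm_num)) hu.1 hI).fun_mul (S.memH2 t ht).2.1
    exact ((hD.differentiableOn (by norm_num)).differentiableAt (W.isOpen.mem_nhds hy)).hasDerivAt
  have hf : IsL2 a b (fun x => f (u t x)) := (W.contf.comp hcont hI).isL2
  set q := dx a b (fun x => D (u t x) * dx a b (u t) x) with hq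
  set F := rhs f D a b ε (u t) with hFdef
  have hFq : ∀ x, F x = ε ^ 2 * q x - f (u t x) := fun x => rfl
  have hqL : IsL2 a b q := by
    have : q = fun x => (ε ^ 2)⁻¹ * (F x + f (u t x)) := by
      ext x
      rw [hFq]
      field_simp
      ring
    rw [this]
    exact (hF.add hf).const_mul _
  have hDF : IsL2 a b (fun x => D (u t x) * F x) :=
    hF.mul (W.contD.comp hcont hI).memLp_top_Ioo
  have hfDF : IsL2 a b (fun x => (f (u t x) * D (u t x)) * F x) :=
    hF.mul (W.contfD.comp hcont hI).memLp_top_Ioo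
  have hΦ := S.tendsto_quotient_comp W.isOpen W.ordConnected W.contf hab ht
    (fun y hy => W.hasDerivAt_integral_D W.left_mem hy) W.contD
  have hG := S.tendsto_quotient_comp W.isOpen W.ordConnected W.contf hab ht
    (fun y hy => W.hasDerivAt_potential hy) W.contfD
  have hmem : ∀ {Θ : ℝ → ℝ}, ContinuousOn Θ I → ∀ᶠ s in 𝓝[<] (0 : ℝ),
      IsL2 a b (fun x => (Θ (u (t + s) x) - Θ (u t x)) / s) := fun {Θ} hΘ => by
    filter_upwards [(tendsto_add_left ht).eventually eventually_mem_nhdsWithin] with s hs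
    have h1 : IsL2 a b (fun x => Θ (u (t + s) x)) :=
      (hΘ.comp ((S.memH1 _ hs).continuousOn hab.le) (S.mem_I _ hs)).isL2
    have h2 : IsL2 a b (fun x => Θ (u t x)) := (hΘ.comp hcont hI).isL2
    simpa only [div_eq_inv_mul] using! (h1.sub h2).const_mul s⁻¹
  have hz : ∀ g : ℝ → ℝ, Tendsto (fun _ : ℝ => norm₂ a b (fun x => g x - g x)) (𝓝[<] 0) (𝓝 0) :=
    fun g => by simpa only [norm₂_self_sub] using tendsto_const_nhds
  have hΦc : ContinuousOn (fun w => ∫ s in α..w, D s) I := fun w hw =>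
    (W.hasDerivAt_integral_D W.left_mem hw).continuousAt.continuousWithinAt
  have l1 := tendsto_integral_mul hΦ (hz q) (hmem hΦc) hDF
    (Eventually.of_forall fun _ => hqL) hqL
  have l2 := tendsto_integral_mul hG (hz fun _ => 1) (hmem W.contG) hfDF
    (Eventually.of_forall fun _ => isL2_const 1) (isL2_const 1)
  have hlim := (l1.const_mul ε).sub (l2.const_mul (1 / ε))
  -- Pointwise, `ε D F q - f D F / ε = (D / ε) F²` because `F = ε² q - f`.
  have hval : d / ε * norm₂ a b F ^ 2 ≤ ε * (∫ x in Ioo a b, D (u t x) * F x * q x) -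
      1 / ε * ∫ x in Ioo a b, f (u t x) * D (u t x) * F x * 1 := by
    rw [norm₂_sq hF, ← integral_const_mul, ← integral_const_mul, ← integral_const_mul,
      ← integral_sub ((integrable_mul hDF hqL).const_mul _)
        ((integrable_mul hfDF (isL2_const 1)).const_mul _)]
    refine setIntegral_mono_on (hF.integrable_sq.const_mul _)
      (((integrable_mul hDF hqL).const_mul _).sub
        ((integrable_mul hfDF (isL2_const 1)).const_mul _)) measurableSet_Ioo fun x hx => ?_
    have e : ε * (D (u t x) * F x * q x) - 1 / ε * (f (u t x) * D (u t x) * F x * 1) =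
        D (u t x) / ε * F x ^ 2 := by
      rw [show F x ^ 2 = F x * (ε ^ 2 * q x - f (u t x)) by rw [← hFq]; ring]
      field_simp
    rw [e]
    gcongr
    exact hdD _ (hI (Ioo_subset_Icc_self hx))
  filter_upwards [hlim.eventually (lt_mem_nhds (hc.trans_le hval)),
    (tendsto_add_left ht).eventually eventually_mem_nhdsWithin, self_mem_nhdsWithin]
    with s h1 h2 (hs : s < 0)
  refine h1.le.trans ?_
  -- Convexity bounds the energy at the earlier time `t + s` from below, which is the useful
  -- direction because `s < 0`.
  have h3 := W.first_variation_le hab.le hε hu (S.memH1 _ h2) hI (S.mem_I _ h2) hp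
    (S.neumann_left t ht) (S.neumann_right t ht)
  rw [le_div_iff₀ (by linarith)]
  refine le_trans (le_of_eq ?_) h3
  have e1 : ∀ g h : ℝ → ℝ, ∫ x in Ioo a b, g x * h x = s * ∫ x in Ioo a b, g x / s * h x := by
    intro g h
    rw [← integral_const_mul]
    congr 1
    ext x
    field_simp [hs.ne]
  rw [e1 (fun x => potential f D α (u (t + s) x) - potential f D α (u t x)) (fun _ => 1),
    e1 (fun x => (∫ y in α..u (t + s) x, D y) - ∫ y in α..u t x, D y) q]
  ring

/-- The displacement in `L²` is controlled by the energy that is dissipated. -/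
theorem norm₂_sub_le (S : IsSolution I f D a b ε u₀ u)
    (W : IsDoubleWell I f D α β) (hD : ContDiffOn ℝ 2 D I) {d : ℝ} (hd : 0 < d)
    (hdD : ∀ u ∈ I, d ≤ D u) (hab : a < b) (hε : 0 < ε) {T : ℝ} (hT : 0 ≤ T) {η : ℝ} (hη : 0 < η) :
    norm₂ a b (fun x => u 0 x - u T x) ≤ η / 2 * T +
      ε / (2 * d * η) * (energy f D α a b ε (u 0) - energy f D α a b ε (u T)) := by
  set K := ε / (2 * d * η) with hK
  have hK0 : 0 < K := by positivity
  have hmaps : MapsTo (fun τ => T - τ) (Icc 0 T) (Ici 0) := fun τ hτ => sub_nonneg.2 hτ.2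
  have hcs : ContinuousOn (fun τ => T - τ) (Icc 0 T) := by fun_prop
  -- Time is reversed, `τ = T - t`, so that right slopes in `τ` are backward quotients in `t`. At `t
  -- = 0`, where the equation is not assumed, only continuity is used.
  have key := image_le_of_liminf_slope_right_le_deriv_boundary (a := 0) (b := T)
    (f := fun τ => norm₂ a b (fun x => u (T - τ) x - u T x) +
      K * (energy f D α a b ε (u T) - energy f D α a b ε (u (T - τ))))
    (B := fun τ => η / 2 * τ) (B' := fun _ => η / 2) ?_ ?_ (by fun_prop) ?_ ?_
    (right_mem_Icc.2 hT)
  · simp only [sub_self] at key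
    linarith
  · exact ((S.continuousOn_norm₂_sub hab hT).comp hcs hmaps).add
      (continuousOn_const.mul (continuousOn_const.sub
        ((S.continuousOn_energy W hab).comp hcs hmaps)))
  · simp [norm₂, normLp]
  · intro τ _
    simpa using ((hasDerivAt_id τ).const_mul (η / 2)).hasDerivWithinAt
  · intro τ hτ ρ hρ
    have ht : 0 < T - τ := sub_pos.2 hτ.2
    set t := T - τ with htdef
    set ℓ := norm₂ a b (rhs f D a b ε (u t)) with hℓ
    obtain ⟨e, he, hesum⟩ : ∃ e > 0, e + K * e = (ρ - η / 2) / 2 :=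
      ⟨(ρ - η / 2) / 2 / (1 + K), div_pos (by linarith) (by linarith), by field_simp⟩
    have ev1 := S.eventually_le_energy_quotient W hD hdD hab hε ht
      (c := d / ε * ℓ ^ 2 - e) (by linarith)
    have ev2 := (S.tendsto_quotient ht).eventually (gt_mem_nhds he)
    have ev3 := (tendsto_add_left ht).eventually eventually_mem_nhdsWithin
    have hmap : Tendsto (fun z => τ - z) (𝓝[>] τ) (𝓝[<] 0) := by
      refine tendsto_nhdsWithin_iff.2 ⟨?_, ?_⟩
      · have : Tendsto (fun z => τ - z) (𝓝 τ) (𝓝 0) := by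
          have hcz : Continuous fun z : ℝ => τ - z := by fun_prop
          simpa using hcz.tendsto τ
        exact this.mono_left nhdsWithin_le_nhds
      · filter_upwards [self_mem_nhdsWithin] with z hz
        exact sub_neg.2 (mem_Ioi.1 hz)
    refine Eventually.frequently ?_
    filter_upwards [hmap.eventually
      (((ev1.and ev2).and (ev3.and (S.isL2_quotient hab ht)))), self_mem_nhdsWithin]
      with z ⟨⟨h1, h2⟩, h3, h4⟩ (hz : τ < z)
    have hs : 0 < z - τ := sub_pos.2 hz
    have htz : t + (τ - z) = T - z := by rw [htdef]; ring
    rw [htz] at h1 h2 h3 h4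
    have hF := S.isL2_rhs W.contf hab ht
    have hquot : norm₂ a b (fun x => u (T - z) x - u t x) ≤ (z - τ) * (ℓ + e) := by
      have h5 : norm₂ a b (fun x => (u (T - z) x - u t x) / (τ - z)) ≤ e + ℓ := by
        have := norm₂_add_le (h4.sub hF) hF
        simp only [Pi.sub_apply, sub_add_cancel] at this
        refine this.trans (add_le_add h2.le le_rfl)
      have h6 : norm₂ a b (fun x => u (T - z) x - u t x) =
          |τ - z| * norm₂ a b (fun x => (u (T - z) x - u t x) / (τ - z)) := by
        rw [← norm₂_const_mul]
        refine norm₂_congr fun x _ => ?_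
        have : τ - z ≠ 0 := by linarith
        field_simp
      rw [h6, abs_of_neg (by linarith), neg_sub]
      gcongr
      linarith
    have htri := S.norm₂_sub_le_add hab h3 ht.le hT
    rw [neg_sub, le_div_iff₀ hs] at h1
    rw [slope_def_field, div_lt_iff₀ hs]
    have h7 : K * ((d / ε * ℓ ^ 2 - e) * (z - τ)) ≤
        K * (energy f D α a b ε (u (T - z)) - energy f D α a b ε (u t)) := by
      gcongr
    -- Young's inequality; `K` is chosen to make the coefficient of `ℓ²` equal to `1 / (2η)`.
    have h8 : ℓ - K * (d / ε) * ℓ ^ 2 ≤ η / 2 := by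
      have : K * (d / ε) = 1 / (2 * η) := by
        rw [hK]
        field_simp
      rw [this]
      have h9 : 0 ≤ (η - ℓ) ^ 2 / (2 * η) := by positivity
      have h10 : (η - ℓ) ^ 2 / (2 * η) = η / 2 - ℓ + 1 / (2 * η) * ℓ ^ 2 := by
        field_simp
        ring
      linarith
    have h11 : (ℓ + e - K * (d / ε * ℓ ^ 2 - e)) * (z - τ) < ρ * (z - τ) := by
      refine mul_lt_mul_of_pos_right ?_ hs
      have : ℓ + e - K * (d / ε * ℓ ^ 2 - e) = (ℓ - K * (d / ε) * ℓ ^ 2) + (e + K * e) := by ring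
      rw [this, hesum]
      linarith
    refine lt_of_le_of_lt ?_ h11
    linarith

end IsSolution

/-! ### Bootstrap and exponentially slow motion. -/

/-- A continuous function that starts at `0` and cannot lie strictly between `κ` and `R` stays
below `κ`. -/
theorem le_of_bootstrap {g : ℝ → ℝ} {T R κ : ℝ} (hg : ContinuousOn g (Icc 0 T)) (h0 : g 0 = 0)
    (hR : 0 < R) (hκ : κ < R) (hstep : ∀ t ∈ Icc 0 T, g t ≤ R → g t ≤ κ) {t : ℝ}
    (ht : t ∈ Icc 0 T) : g t ≤ κ := by
  by_cases h : g t ≤ R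
  · exact hstep t ht h
  · obtain ⟨s, hs, e⟩ := intermediate_value_Icc ht.1 (hg.mono (Icc_subset_Icc_right ht.2))
      (show R ∈ Icc (g 0) (g t) from ⟨by linarith, (not_le.1 h).le⟩)
    have := hstep s ⟨hs.1, hs.2.trans ht.2⟩ e.le
    linarith

theorem normLp_one_le (hab : a ≤ b) {g : ℝ → ℝ} (hg : IsL2 a b g) :
    normLp 1 a b g ≤ ENNReal.ofReal (Real.sqrt (b - a) * norm₂ a b g) := by
  have h1 := ofReal_integral_norm_eq_lintegral_enorm (hg.integrable (by norm_num))
  rw [normLp, eLpNorm_one_eq_lintegral_enorm, ← h1]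
  exact ENNReal.ofReal_le_ofReal (integral_abs_le hab hg)

/-- No measurability of `v` is required: additivity of the lower integral needs it only for the
summand `w - u`. -/
theorem normLp_one_sub_le {u w v : ℝ → ℝ} (h : IsL2 a b (fun x => w x - u x)) :
    normLp 1 a b (fun x => u x - v x) ≤
      normLp 1 a b (fun x => w x - u x) + normLp 1 a b (fun x => w x - v x) := by
  simp only [normLp, eLpNorm_one_eq_lintegral_enorm]
  rw [← lintegral_add_left' h.1.enorm]
  refine lintegral_mono fun x => ?_
  have e : u x - v x = -(w x - u x) + (w x - v x) := by ring
  rw [e]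
  exact (enorm_add_le _ _).trans_eq (by rw [enorm_neg])

theorem energy_congr (f D : ℝ → ℝ) (α : ℝ) (hab : a ≤ b) (ε : ℝ) {u w : ℝ → ℝ}
    (h : EqOn u w (Icc a b)) : energy f D α a b ε u = energy f D α a b ε w := by
  rw [energy_eq f D α hab, energy_eq f D α hab]
  refine setIntegral_congr_fun measurableSet_Ioo fun x hx => ?_
  simp only [density, h (Ioo_subset_Icc_self hx), dx_congr h (Ioo_subset_Icc_self hx)]

theorem normLp_congr (p : ENNReal) {g h : ℝ → ℝ} (hgh : ∀ x ∈ Ioo a b, g x = h x) :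
    normLp p a b g = normLp p a b h := by
  refine eLpNorm_congr_ae ?_
  filter_upwards [ae_restrict_mem measurableSet_Ioo] with x hx
  exact hgh x hx

variable {I : Set ℝ} {f D : ℝ → ℝ} {ε α β : ℝ} {u₀ : ℝ → ℝ} {u : ℝ → ℝ → ℝ}

/-- As long as the energy cannot drop below `E₀ - C₂ e^{-A/ε}` near `v`, a solution whose initial
energy is at most `E₀ + C₁ e^{-A/ε}` moves by `O(√ε)` during the time `m e^{A/ε}`. -/
theorem IsSolution.norm₂_sub_le_sqrt (S : IsSolution I f D a b ε u₀ u)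
    (W : IsDoubleWell I f D α β) (hD : ContDiffOn ℝ 2 D I) {d : ℝ} (hd : 0 < d)
    (hdD : ∀ u ∈ I, d ≤ D u) (hab : a < b) (hε : 0 < ε) {v : ℝ → ℝ} {A E₀ C₁ C₂ δ m : ℝ}
    (hδ : 0 < δ)
    (hlow : ∀ w : ℝ → ℝ, IsH1 a b w → MapsTo w (Icc a b) I →
      normLp 1 a b (fun x => w x - v x) ≤ ENNReal.ofReal δ →
      E₀ - C₂ * Real.exp (-A / ε) ≤ energy f D α a b ε w)
    (hup : energy f D α a b ε u₀ ≤ E₀ + C₁ * Real.exp (-A / ε))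
    (hclose : normLp 1 a b (fun x => u₀ x - v x) ≤ ENNReal.ofReal (δ / 2))
    (hsmall : Real.sqrt (b - a) * (Real.sqrt ε * (m / 2 + (C₁ + C₂) / (2 * d))) < δ / 2)
    {t : ℝ} (ht : t ∈ Icc 0 (m * Real.exp (A / ε))) :
    normLp 1 a b (fun x => u t x - v x) ≤
      ENNReal.ofReal (Real.sqrt (b - a) * (Real.sqrt ε * (m / 2 + (C₁ + C₂) / (2 * d)))) +
        normLp 1 a b (fun x => u₀ x - v x) := by
  have hσ : 0 < Real.sqrt (b - a) := Real.sqrt_pos.2 (sub_pos.2 hab)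
  have hu0 : EqOn (u 0) u₀ (Icc a b) := S.initial
  have hinit : normLp 1 a b (fun x => u 0 x - v x) = normLp 1 a b (fun x => u₀ x - v x) :=
    normLp_congr 1 fun x hx => by rw [hu0 (Ioo_subset_Icc_self hx)]
  have hL1 : ∀ s, 0 ≤ s → normLp 1 a b (fun x => u s x - v x) ≤
      ENNReal.ofReal (Real.sqrt (b - a) * norm₂ a b (fun x => u 0 x - u s x)) +
        normLp 1 a b (fun x => u₀ x - v x) := fun s hs => by
    have h1 := S.isL2_sub hab le_rfl hs
    rw [← hinit]
    refine (normLp_one_sub_le h1).trans ?_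
    gcongr
    exact normLp_one_le hab.le h1
  have hcont : ContinuousOn (fun s => norm₂ a b (fun x => u 0 x - u s x))
      (Icc 0 (m * Real.exp (A / ε))) := by
    have := (S.continuousOn_norm₂_sub hab le_rfl).mono
      (Icc_subset_Ici_self : Icc 0 (m * Real.exp (A / ε)) ⊆ Ici 0)
    exact this.congr fun s _ => norm₂_sub_comm _ _
  -- Below the threshold `R`, `u s` is still `δ`-close to `v` in L¹, so the energy lower bound
  -- applies there and improves the estimate to `κ < R`.
  have hb := le_of_bootstrap (R := δ / 2 / Real.sqrt (b - a))
    (κ := Real.sqrt ε * (m / 2 + (C₁ + C₂) / (2 * d))) hcont (norm₂_self_sub _)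
    (by positivity) (by rwa [lt_div_iff₀' hσ]) ?_ ht
  · refine (hL1 t ht.1).trans ?_
    gcongr
  · intro s hs hsR
    rw [le_div_iff₀' hσ] at hsR
    have hnear : normLp 1 a b (fun x => u s x - v x) ≤ ENNReal.ofReal δ := by
      refine (hL1 s hs.1).trans ?_
      rw [← add_halves δ, ENNReal.ofReal_add (by linarith) (by linarith)]
      exact add_le_add (ENNReal.ofReal_le_ofReal hsR) hclose
    have hE := hlow (u s) (S.memH1 s hs.1) (S.mem_I s hs.1) hnear
    have hE0 : energy f D α a b ε (u 0) ≤ E₀ + C₁ * Real.exp (-A / ε) := by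
      rwa [energy_congr f D α hab.le ε hu0]
    have hsε : 0 < Real.sqrt ε := Real.sqrt_pos.2 hε
    have hee : Real.exp (-A / ε) * Real.exp (A / ε) = 1 := by
      rw [← Real.exp_add, neg_div, neg_add_cancel, Real.exp_zero]
    -- This `η` balances the two terms: `η` times the time horizon and `ε / η` times the available
    -- energy are both `O(√ε)`.
    have key := S.norm₂_sub_le W hD hd hdD hab hε hs.1
      (η := Real.sqrt ε * Real.exp (-A / ε)) (by positivity)
    refine key.trans ?_
    have h1 : Real.sqrt ε * Real.exp (-A / ε) / 2 * s ≤ Real.sqrt ε * (m / 2) := by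
      calc _ ≤ Real.sqrt ε * Real.exp (-A / ε) / 2 * (m * Real.exp (A / ε)) := by
            gcongr
            exact hs.2
        _ = Real.sqrt ε * (m / 2) * (Real.exp (-A / ε) * Real.exp (A / ε)) := by ring
        _ = _ := by rw [hee, mul_one]
    have h2 : ε / (2 * d * (Real.sqrt ε * Real.exp (-A / ε))) *
        (energy f D α a b ε (u 0) - energy f D α a b ε (u s)) ≤
        Real.sqrt ε * ((C₁ + C₂) / (2 * d)) := by
      calc _ ≤ ε / (2 * d * (Real.sqrt ε * Real.exp (-A / ε))) *
            ((C₁ + C₂) * Real.exp (-A / ε)) := by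
            gcongr
            linarith
        _ = (Real.sqrt ε * Real.sqrt ε) / (2 * d * (Real.sqrt ε * Real.exp (-A / ε))) *
            ((C₁ + C₂) * Real.exp (-A / ε)) := by rw [Real.mul_self_sqrt hε.le]
        _ = _ := by field_simp
    linarith

end AllenCahn

theorem mainTheorem1
    (I : Set ℝ) (hI_open : IsOpen I) (hI_int : I.OrdConnected)
    (f D : ℝ → ℝ) (hf : ContDiffOn ℝ 2 f I) (hD : ContDiffOn ℝ 2 D I)
    (d : ℝ) (hd : 0 < d) (hdD : ∀ u ∈ I, d ≤ D u)
    (α β : ℝ) (hαβ : α < β) (hαβI : Icc α β ⊆ I)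
    (hfα : f α = 0) (hfβ : f β = 0) (hf'α : 0 < deriv f α) (hf'β : 0 < deriv f β)
    (hint0 : (∫ s in α..β, f s * D s) = 0)
    (hint1 : ∀ u ∈ I, u ≠ α → u ≠ β → 0 < ∫ s in α..u, f s * D s)
    (a b : ℝ) (hab : a < b)
    (N : ℕ) (h : Fin N → ℝ) (r : ℝ) (v : ℝ → ℝ) (hv : AllenCahn.IsStep α β a b N h r v)
    (A : ℝ) (hA : A ∈ Ioo 0 (r * Real.sqrt (2 * AllenCahn.lam f D α β)))
    (u₀ : ℝ → ℝ → ℝ) (u : ℝ → ℝ → ℝ → ℝ)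
    (hu₀_H1 : ∀ᶠ ε in 𝓝[>] (0 : ℝ), AllenCahn.IsH1 a b (u₀ ε))
    (hu₀_bdd : ∀ᶠ ε in 𝓝[>] (0 : ℝ), ∃ M₁ M₂ : ℝ, M₁ < M₂ ∧ Icc M₁ M₂ ⊆ I ∧
      ∀ x ∈ Icc a b, M₁ ≤ u₀ ε x ∧ u₀ ε x ≤ M₂)
    (hu₀_lim : Tendsto (fun ε => AllenCahn.normLp 1 a b (fun x => u₀ ε x - v x))
      (𝓝[>] (0 : ℝ)) (𝓝 0))
    (C : ℝ) (hC : 0 < C)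
    (hu₀_energy : ∀ᶠ ε in 𝓝[>] (0 : ℝ), AllenCahn.energy f D α a b ε (u₀ ε) ≤
      N * AllenCahn.gammaZero f D α β + C * Real.exp (-A / ε))
    (hu : ∀ᶠ ε in 𝓝[>] (0 : ℝ), AllenCahn.IsSolution I f D a b ε (u₀ ε) (u ε)) :
    ∀ m : ℝ, 0 < m →
      Tendsto
        (fun ε => ⨆ t ∈ Icc 0 (m * Real.exp (A / ε)),
          AllenCahn.normLp 1 a b (fun x => u ε t x - v x))
        (𝓝[>] (0 : ℝ)) (𝓝 0) := by
  intro m _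
  have W : AllenCahn.IsDoubleWell I f D α β :=
    { isOpen := hI_open
      ordConnected := hI_int
      contf := hf.continuousOn
      contD := hD.continuousOn
      D_pos := fun u hu => hd.trans_le (hdD u hu)
      lt := hαβ
      left_mem := hαβI (left_mem_Icc.2 hαβ.le)
      right_mem := hαβI (right_mem_Icc.2 hαβ.le)
      f_left := hfα
      f_right := hfβ
      deriv_left := hf'α
      deriv_right := hf'β
      potential_right := hint0
      potential_pos := hint1 }
  -- `δ` and `C₂` do not depend on `ε`, so the displacement bound is a fixed multiple of `√ε` and
  -- eventually drops below `δ / 2`.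
  obtain ⟨δ, hδ, C₂, -, hlow⟩ := W.exists_energy_lower_bound hab.le hv hA
  have hκ : Tendsto (fun ε => Real.sqrt (b - a) *
      (Real.sqrt ε * (m / 2 + (C + C₂) / (2 * d)))) (𝓝[>] 0) (𝓝 0) := by
    have hc : Continuous fun ε => Real.sqrt (b - a) *
        (Real.sqrt ε * (m / 2 + (C + C₂) / (2 * d))) := by fun_prop
    simpa using (hc.tendsto 0).mono_left nhdsWithin_le_nhds
  have hbound : Tendsto (fun ε => ENNReal.ofReal (Real.sqrt (b - a) *
      (Real.sqrt ε * (m / 2 + (C + C₂) / (2 * d)))) +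
      AllenCahn.normLp 1 a b (fun x => u₀ ε x - v x)) (𝓝[>] 0) (𝓝 0) := by
    simpa using (ENNReal.tendsto_ofReal hκ).add hu₀_lim
  refine tendsto_of_tendsto_of_tendsto_of_le_of_le' tendsto_const_nhds hbound
    (Eventually.of_forall fun _ => zero_le) ?_
  filter_upwards [hu, hu₀_energy, hκ.eventually (gt_mem_nhds (half_pos hδ)),
    hu₀_lim.eventually (gt_mem_nhds (ENNReal.ofReal_pos.2 (half_pos hδ))), self_mem_nhdsWithin]
    with ε S hE hsmall hclose hε
  exact iSup₂_le fun t ht => S.norm₂_sub_le_sqrt W hD hd hdD hab hε hδ (hlow ε hε) hE hclose.le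
    hsmall ht
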